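/- Let $k$ be a field and let $H$ be a finite-dimensional unimodular Hopf algebra over $k$ (its left- and right-integrals coincide) with a ribbon structure: an invertible universal $R$-matrix $R=\sum a\otimes b$ (with $R\Delta(x)=\Delta^{\mathrm{op}}(x)R$, $(\Delta\otimes\mathrm{id})R=R_{13}R_{23}$, $(\mathrm{id}\otimes\Delta)R=R_{13}R_{12}$) and a central element $v\in H$ with $v^2=uS(u)$, $S(v)=v$, $\epsilon(v)=1$, $R_{21}R\,\Delta(v)=v\otimes v$, where $u=\sum S(b)a$. Put $G=uv^{-1}$. Let $H^*$ be the dual Hopf algebra with respect to the pairing $\langle\varphi\otimes\psi,x\otimes y\rangle=\varphi(y)\psi(x)$, that is, $(\varphi\psi)(x)=\varphi(x'')\psi(x')$, $\varphi'(y)\varphi''(x)=\varphi(xy)$, $1=\epsilon$, $\epsilon(\varphi)=\varphi(1)$, $S(\varphi)=\varphi\circ S$. A coribbon structure on a Hopf algebra $A$ consists of a universal $r$-form $r\colon A\otimes A\to k$, i.e. a convolution invertible form (inverse $\bar r$) with $x'y'\,r(x''\otimes y'')=r(x'\otimes y')\,y''x''$, $r(xy\otimes z)=r(y\otimes z')r(x\otimes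 z'')$, $r(x\otimes yz)=r(x'\otimes y)r(x''\otimes z)$, and of a convolution invertible form $\nu\colon A\to k$ (inverse $\bar\nu$) with $\nu(x')x''=x'\nu(x'')$, $\nu(xy)=\nu(x')\nu(y')\,r(x''\otimes y'')\,r(y'''\otimes x''')$, $\nu\circ S=\nu$. Its copivotal form is $w(x)=r(S(x')\otimes x'')\,\nu(x''')$, with convolution inverse $\bar w=w\circ S$. An element $t\in A$ is a dual quantum trace if $\Delta^{\mathrm{op}}(t)=(\mathrm{id}\otimes S^2)\Delta(t)$, and it is $S$-compatible if $\bar w(t')S(t'')=\bar w(t')t''$. A left-integral is an element $\ell\in A$ with $x\ell=\epsilon(x)\ell$ for all $x\in A$. For an $S$-compatible dual quantum trace $\ell\in A$ ($A$ finite-dimensional) and a diagram (blackboard framing, with $m\ge 0$ components) of an unoriented framed link $L$ in $S^3$, the generalized Hennings–Kauffman–Radford evaluation $\langle L\rangle_\ell^{(A)}\in k$ is obtained as follows. Number, orient and base the components, label them with a formal finite-dimensional right $A$-comodule $\mathcal X$ (downward strands carry $\mathcal X$, upward strands $\mathcal X^*$), and compute the diagram, from top to bottom, in the ribbon category of $A$-comodules,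 whose braiding $v\otimes w\mapsto w_0\otimes v_0\,r(w_1\otimes v_1)$ is the negative crossing and whose right (co)evaluations involve $w$ (resp. $\bar w$). The result is a linear form in one copy per component of the dual quantum character $T_{\mathcal X}$; replace each copy of $T_{\mathcal X}$ by $\ell$. For $\beta,\gamma\in k\setminus\{0\}$ with $\bar\nu(\ell)=\gamma^2/\beta$ and $\nu(\ell)=\beta$, set $$I(M_L)=\beta^{\sigma}\,\gamma^{-\sigma-m-1}\,\langle L\rangle^{(A)}_\ell ,$$ where $\sigma$ is the signature of the linking matrix of $L$ with the framing numbers on its diagonal. Let $\lambda\colon H\to k$ satisfy $\lambda(x')x''=\lambda(x)1$ for all $x$ (a right-cointegral). The Kauffman–Radford invariant of the framed link $K$ is $$\mathrm{INV}(K)=[\lambda(v)\lambda(v^{-1})]^{-m/2}\,[\lambda(v)/\lambda(v^{-1})]^{-\sigma/2}\,\mathrm{TR}(K).$$ Here $\mathrm{TR}(K)$ is computed from a diagram by placing at each negative crossing the legs $a$, $b$ of $R$ on the over- and undercrossing strand (at positive crossings the legs of $R^{-1}$), sliding, on each component, these beads back to a base point on a strand traversed upward, applying $S$ (resp. $S^{-1}$)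 whenever a bead passes an extremum counterclockwise (resp. clockwise), multiplying them in the upward order (later ones on the left) to a product $y$, and taking the product over all components of $\mathrm{tr}(G^{d}y)$, where $d$ is the Whitney degree of the component and $\mathrm{tr}(x)=\lambda(Gx)$. Then: 1. $H^*$ is coribbon, with $r(\varphi\otimes\psi)=\sum\varphi(b)\psi(a)$ and $\nu(\varphi)=\varphi(v^{-1})$. 2. $H^*$ has a nonzero left-integral $\ell$, unique up to a scalar, and $\ell$ is an $S$-compatible dual quantum trace. 3. Let $\ell\in H^*$ be a nonzero left-integral. As a linear form on $H$, it is a right-cointegral $\lambda$ of $H$. If $\beta,\gamma\in k\setminus\{0\}$ satisfy $\bar\nu(\ell)=\gamma^2/\beta$ and $\nu(\ell)=\beta$, then $\gamma^2=\lambda(v)\lambda(v^{-1})$ and $(\gamma/\beta)^2=\lambda(v)/\lambda(v^{-1})$, and, with the square roots $\gamma$ and $\gamma/\beta$ chosen in $\mathrm{INV}$, for every diagram of a framed link $L$ and every choice of numbering, orientations and base points (upward at the base points), $$I(M_L)=\gamma^{-1}\,\mathrm{INV}(L),\qquad\text{equivalently}\qquad \mathrm{INV}(L)=\gamma\,I(M_L).$$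 -/

import Mathlib

open scoped TensorProduct
open Coalgebra HopfAlgebra

/-! ## Convolution and the dual Hopf algebra -/

/-- The convolution product `f ⋆ g = (x ↦ f(x') g(x''))` of linear maps from a coalgebra to an
algebra. -/
noncomputable def conv {k C B : Type*} [Field k] [AddCommGroup C] [Module k C] [Coalgebra k C]
    [Ring B] [Algebra k B] (f g : C →ₗ[k] B) : C →ₗ[k] B :=
  LinearMap.mul' k B ∘ₗ TensorProduct.map f g ∘ₗ comul

/-- The vector space underlying the dual Hopf algebra `H* = Hom(H, k)`. Its Hopf algebra structure
is dual to that of `H` with respect to the pairing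
`⟨φ ⊗ ψ, x ⊗ y⟩ = φ(y) ψ(x)` of `H* ⊗ H*` with `H ⊗ H`, that is
`(φ ψ)(x) = φ(x'') ψ(x')`, `1 = ε`, `φ'(y) φ''(x) = φ(x y)`, `ε(φ) = φ(1)`, `S(φ) = φ ∘ S`. -/
def DualHopf (k H : Type*) [Field k] [Ring H] [HopfAlgebra k H] := H →ₗ[k] k

namespace DualHopf

variable {k H : Type*} [Field k] [Ring H] [HopfAlgebra k H]

instance instAddCommGroup : AddCommGroup (DualHopf k H) :=
  inferInstanceAs (AddCommGroup (H →ₗ[k] k))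

instance instModule : Module k (DualHopf k H) :=
  inferInstanceAs (Module k (H →ₗ[k] k))

instance instFinite [FiniteDimensional k H] : FiniteDimensional k (DualHopf k H) :=
  inferInstanceAs (FiniteDimensional k (Module.Dual k H))

/-- An element of `H*`, viewed as a linear form on `H`. -/
def toForm : DualHopf k H ≃ₗ[k] (H →ₗ[k] k) := LinearEquiv.refl k _

theorem ext_toForm {φ ψ : DualHopf k H} (h : ∀ x, toForm φ x = toForm ψ x) : φ = ψ :=
  toForm.injective (LinearMap.ext h)

/-- The multiplication `(φ ψ)(x) = φ(x'') ψ(x')`. -/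
noncomputable instance instMul : Mul (DualHopf k H) where
  mul φ ψ := toForm.symm (conv (toForm ψ) (toForm φ))

noncomputable instance instOne : One (DualHopf k H) where
  one := toForm.symm counit

theorem toForm_mul (φ ψ : DualHopf k H) :
    toForm (φ * ψ) = conv (toForm ψ) (toForm φ) := rfl

theorem toForm_one : toForm (1 : DualHopf k H) = counit := rfl

theorem mul_apply {ι : Type*} (φ ψ : DualHopf k H) {x : H} (ρ : Coalgebra.Repr k x ι) :
    toForm (φ * ψ) x = ∑ i ∈ ρ.index, toForm φ (ρ.right i) * toForm ψ (ρ.left i) := by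
  simp [toForm_mul, conv, ← ρ.eq, mul_comm]

theorem toConv_mul (φ ψ : DualHopf k H) :
    WithConv.toConv (toForm (φ * ψ)) =
      WithConv.toConv (toForm ψ) * WithConv.toConv (toForm φ) := rfl

theorem toConv_one : WithConv.toConv (toForm (1 : DualHopf k H)) = 1 := rfl

theorem toConv_toForm_injective :
    Function.Injective fun φ : DualHopf k H => WithConv.toConv (toForm φ) :=
  fun _ _ h => toForm.injective (WithConv.toConv_injective h)

noncomputable instance instRing : Ring (DualHopf k H) :=
  { DualHopf.instAddCommGroup, DualHopf.instMul, DualHopf.instOne with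
    mul_assoc := fun a b c => toConv_toForm_injective (by simp only [toConv_mul, mul_assoc])
    one_mul := fun a => toConv_toForm_injective (by simp only [toConv_mul, toConv_one, mul_one])
    mul_one := fun a => toConv_toForm_injective (by simp only [toConv_mul, toConv_one, one_mul])
    zero_mul := fun a => toConv_toForm_injective (by
      simp only [toConv_mul, map_zero, WithConv.toConv_zero, mul_zero])
    mul_zero := fun a => toConv_toForm_injective (by
      simp only [toConv_mul, map_zero, WithConv.toConv_zero, zero_mul])
    left_distrib := fun a b c => toConv_toForm_injective (by
      simp only [toConv_mul, map_add, WithConv.toConv_add, add_mul])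
    right_distrib := fun a b c => toConv_toForm_injective (by
      simp only [toConv_mul, map_add, WithConv.toConv_add, mul_add]) }

noncomputable instance instAlgebra : Algebra k (DualHopf k H) :=
  Algebra.ofModule
    (fun c a b => toConv_toForm_injective (by
      simp only [toConv_mul, map_smul, WithConv.toConv_smul, mul_smul_comm]))
    (fun c a b => toConv_toForm_injective (by
      simp only [toConv_mul, map_smul, WithConv.toConv_smul, smul_mul_assoc]))

theorem toForm_algebraMap (c : k) (x : H) :
    toForm (algebraMap k (DualHopf k H) c) x = c * counit (R := k) x := by
  rw [Algebra.algebraMap_eq_smul_one, map_smul, toForm_one]; rfl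

/-- `φ ⊗ m ↦ φ(x) m`. -/
noncomputable def evalLeft {M : Type*} [AddCommGroup M] [Module k M] (x : H) :
    DualHopf k H ⊗[k] M →ₗ[k] M :=
  TensorProduct.lid k M ∘ₗ LinearMap.rTensor M (LinearMap.applyₗ x ∘ₗ toForm.toLinearMap)

@[simp] theorem evalLeft_tmul {M : Type*} [AddCommGroup M] [Module k M] (x : H)
    (φ : DualHopf k H) (m : M) : evalLeft x (φ ⊗ₜ[k] m) = toForm φ x • m := by
  simp [evalLeft]

/-- The form `x ↦ φ(x y)`. -/
noncomputable def shift (φ : DualHopf k H) (y : H) : DualHopf k H :=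
  toForm.symm (toForm φ ∘ₗ LinearMap.mulRight k y)

@[simp] theorem toForm_shift (φ : DualHopf k H) (y x : H) :
    toForm (shift φ y) x = toForm φ (x * y) := rfl

theorem evalLeft_lTensor {M N : Type*} [AddCommGroup M] [Module k M] [AddCommGroup N] [Module k N]
    (f : M →ₗ[k] N) (x : H) (t : DualHopf k H ⊗[k] M) :
    evalLeft x (f.lTensor _ t) = f (evalLeft x t) := by
  induction t using TensorProduct.induction_on with
  | zero => simp
  | tmul φ m => simp
  | add a b ha hb => simp only [map_add, ha, hb]

/-- The counit `ε(φ) = φ(1)`. -/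
noncomputable def counitDual : DualHopf k H →ₗ[k] k :=
  LinearMap.applyₗ (1 : H) ∘ₗ toForm.toLinearMap

theorem counitDual_apply (φ : DualHopf k H) : counitDual φ = toForm φ 1 := rfl

theorem evalLeft_mul {ι κ : Type*} {x y : H} (ρ : Coalgebra.Repr k x ι) (σ : Coalgebra.Repr k y κ)
    (s t : DualHopf k H ⊗[k] DualHopf k H) :
    toForm (evalLeft y (s * t)) x =
      ∑ j ∈ σ.index, ∑ i ∈ ρ.index,
        toForm (evalLeft (σ.right j) s) (ρ.right i) *
          toForm (evalLeft (σ.left j) t) (ρ.left i) := by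
  induction s using TensorProduct.induction_on with
  | zero => simp
  | tmul a b =>
    induction t using TensorProduct.induction_on with
    | zero => simp
    | tmul c d =>
      simp only [Algebra.TensorProduct.tmul_mul_tmul, evalLeft_tmul, map_smul,
        LinearMap.smul_apply, smul_eq_mul, mul_apply _ _ ρ, mul_apply _ _ σ,
        Finset.sum_mul, Finset.mul_sum]
      rw [Finset.sum_comm]
      refine Finset.sum_congr rfl fun j _ => Finset.sum_congr rfl fun i _ => by ring
    | add t u ht hu =>
      simp only [mul_add, map_add, LinearMap.add_apply, ht, hu, Finset.sum_add_distrib]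
  | add s u hs hu =>
    simp only [add_mul, map_add, LinearMap.add_apply, hs, hu, Finset.sum_add_distrib]

theorem mul_apply_mul {ι κ : Type*} {x y : H} (ρ : Coalgebra.Repr k x ι)
    (σ : Coalgebra.Repr k y κ) (φ ψ : DualHopf k H) :
    toForm (φ * ψ) (x * y) =
      ∑ j ∈ σ.index, ∑ i ∈ ρ.index,
        toForm φ (ρ.right i * σ.right j) * toForm ψ (ρ.left i * σ.left j) := by
  rw [toForm_mul]
  simp only [conv, LinearMap.comp_apply, Bialgebra.comul_mul, ← ρ.eq, ← σ.eq, Finset.sum_mul,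
    Finset.mul_sum, Algebra.TensorProduct.tmul_mul_tmul, map_sum, TensorProduct.map_tmul,
    LinearMap.mul'_apply]
  refine Finset.sum_congr rfl fun j _ => Finset.sum_congr rfl fun i _ => by ring

/-- The antipode `S(φ) = φ ∘ S`. -/
noncomputable def antipodeDual : DualHopf k H →ₗ[k] DualHopf k H where
  toFun φ := toForm.symm (toForm φ ∘ₗ antipode k)
  map_add' _ _ := rfl
  map_smul' _ _ := rfl

theorem antipodeDual_apply (φ : DualHopf k H) (x : H) :
    toForm (antipodeDual φ) x = toForm φ (antipode k x) := rfl

variable [FiniteDimensional k H]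

/-- `H* ⊗ M ≃ Hom(H, M)`, sending `φ ⊗ m` to `x ↦ φ(x) m`. -/
noncomputable def homEquiv (M : Type*) [AddCommGroup M] [Module k M] :
    DualHopf k H ⊗[k] M ≃ₗ[k] (H →ₗ[k] M) :=
  TensorProduct.congr toForm (LinearEquiv.refl k M) ≪≫ₗ dualTensorHomEquiv k H M

theorem homEquiv_apply {M : Type*} [AddCommGroup M] [Module k M] (t : DualHopf k H ⊗[k] M)
    (x : H) : homEquiv M t x = evalLeft x t := by
  induction t using TensorProduct.induction_on with
  | zero => rw [map_zero, map_zero, LinearMap.zero_apply]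
  | tmul φ m => rw [evalLeft_tmul]; simp [homEquiv]
  | add a b ha hb => rw [map_add, map_add, LinearMap.add_apply, ha, hb]

theorem evalLeft_ext {M : Type*} [AddCommGroup M] [Module k M] {s t : DualHopf k H ⊗[k] M}
    (h : ∀ x : H, evalLeft x s = evalLeft x t) : s = t :=
  (homEquiv M).injective (LinearMap.ext fun x => by rw [homEquiv_apply, homEquiv_apply, h])

/-- The comultiplication of `H*`, the element `φ' ⊗ φ''` determined by
`φ'(y) φ''(x) = φ(x y)`. -/
noncomputable def comulDual : DualHopf k H →ₗ[k] DualHopf k H ⊗[k] DualHopf k H :=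
  (homEquiv (DualHopf k H)).symm.toLinearMap ∘ₗ
    LinearMap.mk₂ k shift
      (fun _ _ _ => rfl) (fun _ _ _ => rfl)
      (fun φ y z => ext_toForm fun x => by simp [mul_add])
      (fun c φ y => ext_toForm fun x => by simp)

theorem evalLeft_comulDual (φ : DualHopf k H) (y : H) :
    evalLeft y (comulDual φ) = shift φ y := by
  rw [← homEquiv_apply, comulDual, LinearMap.comp_apply, LinearEquiv.coe_coe,
    LinearEquiv.apply_symm_apply]
  rfl

theorem evalLeft_assoc (y z : H) (t : DualHopf k H ⊗[k] DualHopf k H) :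
    evalLeft y (evalLeft z (TensorProduct.assoc k _ _ _ (comulDual.rTensor _ t))) =
      evalLeft (y * z) t := by
  have aux : ∀ (s : DualHopf k H ⊗[k] DualHopf k H) (b : DualHopf k H),
      evalLeft z (TensorProduct.assoc k _ _ _ (s ⊗ₜ[k] b)) = evalLeft z s ⊗ₜ[k] b := by
    intro s b
    induction s using TensorProduct.induction_on with
    | zero => simp
    | tmul φ m => simp [TensorProduct.smul_tmul']
    | add a c ha hc => simp only [TensorProduct.add_tmul, map_add, ha, hc]
  induction t using TensorProduct.induction_on with
  | zero => simp
  | tmul a b =>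
    rw [LinearMap.rTensor_tmul, aux, evalLeft_comulDual, evalLeft_tmul, evalLeft_tmul,
      toForm_shift]
  | add a b ha hb => simp only [map_add, ha, hb]

noncomputable instance instCoalgebra : Coalgebra k (DualHopf k H) where
  comul := comulDual
  counit := counitDual
  coassoc := LinearMap.ext fun φ => evalLeft_ext fun z => evalLeft_ext fun y => by
    simp only [LinearMap.comp_apply, LinearEquiv.coe_coe]
    rw [evalLeft_assoc, evalLeft_lTensor, evalLeft_comulDual, evalLeft_comulDual,
      evalLeft_comulDual]
    exact ext_toForm fun x => by simp [mul_assoc]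
  rTensor_counit_comp_comul := LinearMap.ext fun φ => by
    apply (TensorProduct.lid k (DualHopf k H)).injective
    exact (evalLeft_comulDual φ 1).trans (ext_toForm fun x => by simp)
  lTensor_counit_comp_comul := LinearMap.ext fun φ => evalLeft_ext fun y => by
    rw [LinearMap.comp_apply, evalLeft_lTensor, evalLeft_comulDual]
    simp [counitDual_apply]

theorem comul_eq (φ : DualHopf k H) : comul (R := k) φ = comulDual φ := rfl

theorem counit_eq (φ : DualHopf k H) : counit (R := k) φ = toForm φ 1 := rfl

noncomputable instance instBialgebra : Bialgebra k (DualHopf k H) :=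
  Bialgebra.mk' k (DualHopf k H)
    (by rw [counit_eq, toForm_one]; exact Bialgebra.counit_one)
    (fun {φ ψ} => by
      simp only [counit_eq, toForm_mul, conv, LinearMap.comp_apply, Bialgebra.comul_one,
        Algebra.TensorProduct.one_def, TensorProduct.map_tmul, LinearMap.mul'_apply, mul_comm])
    (evalLeft_ext fun y => by
      rw [comul_eq, evalLeft_comulDual]
      exact ext_toForm fun x => by
        simp [toForm_one, Algebra.TensorProduct.one_def, mul_comm])
    (fun {φ ψ} => evalLeft_ext fun y => ext_toForm fun x => by
      rw [comul_eq, comul_eq, comul_eq, evalLeft_comulDual, toForm_shift,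
        mul_apply_mul (ℛ k x) (ℛ k y), evalLeft_mul (ℛ k x) (ℛ k y)]
      simp only [evalLeft_comulDual, toForm_shift])

noncomputable instance instHopfAlgebra : HopfAlgebra k (DualHopf k H) where
  antipode := antipodeDual
  mul_antipode_rTensor_comul := LinearMap.ext fun φ => ext_toForm fun x => by
    have key : ∀ t : DualHopf k H ⊗[k] DualHopf k H,
        toForm (LinearMap.mul' k (DualHopf k H) (antipodeDual.rTensor _ t)) x =
          ∑ i ∈ (ℛ k x).index,
            toForm (evalLeft (antipode k ((ℛ k x).right i)) t) ((ℛ k x).left i) := by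
      intro t
      induction t using TensorProduct.induction_on with
      | zero => simp
      | tmul a b => simp [mul_apply a.antipodeDual b (ℛ k x), antipodeDual_apply]
      | add a b ha hb => simp only [map_add, LinearMap.add_apply, ha, hb, Finset.sum_add_distrib]
    refine (key (comulDual φ)).trans ?_
    simp only [evalLeft_comulDual, toForm_shift]
    rw [← map_sum, sum_mul_antipode_eq_smul, LinearMap.comp_apply, Algebra.linearMap_apply,
      toForm_algebraMap, counit_eq, map_smul, smul_eq_mul, mul_comm]
  mul_antipode_lTensor_comul := LinearMap.ext fun φ => ext_toForm fun x => by
    have key : ∀ t : DualHopf k H ⊗[k] DualHopf k H,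
        toForm (LinearMap.mul' k (DualHopf k H) (antipodeDual.lTensor _ t)) x =
          ∑ i ∈ (ℛ k x).index,
            toForm (evalLeft ((ℛ k x).right i) t) (antipode k ((ℛ k x).left i)) := by
      intro t
      induction t using TensorProduct.induction_on with
      | zero => simp
      | tmul a b => simp [mul_apply a b.antipodeDual (ℛ k x), antipodeDual_apply]
      | add a b ha hb => simp only [map_add, LinearMap.add_apply, ha, hb, Finset.sum_add_distrib]
    refine (key (comulDual φ)).trans ?_
    simp only [evalLeft_comulDual, toForm_shift]
    rw [← map_sum, sum_antipode_mul_eq_smul, LinearMap.comp_apply, Algebra.linearMap_apply,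
      toForm_algebraMap, counit_eq, map_smul, smul_eq_mul, mul_comm]

end DualHopf

/-! ## Coribbon Hopf algebras, integrals and dual quantum traces -/

section Coribbon

variable (k A : Type*) [Field k] [Ring A] [HopfAlgebra k A]

/-- A coribbon structure on a Hopf algebra `A`: a coquasitriangular structure given by a universal
`r`-form `r` with convolution inverse `rbar`, and a dual central, convolution invertible universal
ribbon form `nu` with convolution inverse `nubar`. -/
structure CoribbonStructure where
  /-- the universal `r`-form -/
  r : A ⊗[k] A →ₗ[k] k
  /-- the convolution inverse of the universal `r`-form -/
  rbar : A ⊗[k] A →ₗ[k] k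
  /-- the universal ribbon form -/
  nu : A →ₗ[k] k
  /-- the convolution inverse of the universal ribbon form -/
  nubar : A →ₗ[k] k
  /-- `ε(x'y') r(x'' ⊗ y'') = r(x ⊗ y)` -/
  counit_conv_r : conv (counit ∘ₗ LinearMap.mul' k A) r = r
  /-- `r(x' ⊗ y') ε(y''x'') = r(x ⊗ y)` -/
  r_conv_counit :
    conv r (counit ∘ₗ LinearMap.mul' k A ∘ₗ (TensorProduct.comm k A A).toLinearMap) = r
  /-- `r̄(x' ⊗ y') r(x'' ⊗ y'') = ε(yx)` -/
  rbar_conv_r :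
    conv rbar r = counit ∘ₗ LinearMap.mul' k A ∘ₗ (TensorProduct.comm k A A).toLinearMap
  /-- `r(x' ⊗ y') r̄(x'' ⊗ y'') = ε(xy)` -/
  r_conv_rbar : conv r rbar = counit ∘ₗ LinearMap.mul' k A
  /-- `x'y' r(x'' ⊗ y'') = r(x' ⊗ y') y''x''` -/
  mul_conv_r :
    conv (LinearMap.mul' k A) (Algebra.linearMap k A ∘ₗ r) =
      conv (Algebra.linearMap k A ∘ₗ r)
        (LinearMap.mul' k A ∘ₗ (TensorProduct.comm k A A).toLinearMap)
  /-- `r(xy ⊗ z) = r(y ⊗ z') r(x ⊗ z'')` -/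
  r_mul_left : ∀ x y : A,
    TensorProduct.curry r (x * y) = conv (TensorProduct.curry r y) (TensorProduct.curry r x)
  /-- `r(x ⊗ yz) = r(x' ⊗ y) r(x'' ⊗ z)` -/
  r_mul_right : ∀ y z : A,
    (TensorProduct.curry r).flip (y * z) =
      conv ((TensorProduct.curry r).flip y) ((TensorProduct.curry r).flip z)
  nu_conv_nubar : conv nu nubar = counit
  nubar_conv_nu : conv nubar nu = counit
  /-- `ν(x') x'' = x' ν(x'')` -/
  nu_central :
    conv (Algebra.linearMap k A ∘ₗ nu) LinearMap.id =
      conv LinearMap.id (Algebra.linearMap k A ∘ₗ nu)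
  /-- `ν(xy) = ν(x') ν(y') q(x'' ⊗ y'')` with `q(x ⊗ y) = r(x' ⊗ y') r(y'' ⊗ x'')` -/
  nu_mul :
    nu ∘ₗ LinearMap.mul' k A =
      conv (LinearMap.mul' k k ∘ₗ TensorProduct.map nu nu)
        (conv r (r ∘ₗ (TensorProduct.comm k A A).toLinearMap))
  nu_antipode : nu ∘ₗ antipode k = nu

variable {A}

/-- A left-integral `ℓ ∈ A`: `x ℓ = ε(x) ℓ` for all `x`. -/
def IsLeftIntegral (l : A) : Prop := ∀ x : A, x * l = counit (R := k) x • l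

/-- A right-integral `ℓ ∈ A`: `ℓ x = ε(x) ℓ` for all `x`. -/
def IsRightIntegral (l : A) : Prop := ∀ x : A, l * x = counit (R := k) x • l

/-- A dual quantum trace: `Δᵒᵖ(t) = (id ⊗ S²) Δ(t)`. -/
def IsDualQuantumTrace (t : A) : Prop :=
  TensorProduct.comm k A A (comul t) =
    TensorProduct.map LinearMap.id (antipode k ∘ₗ antipode k) (comul t)

namespace CoribbonStructure

variable {k} (C : CoribbonStructure k A)

/-- The second dual Drinfel'd element `v(x) = r(S(x') ⊗ x'')`. -/
noncomputable def drinfeld : A →ₗ[k] k :=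
  C.r ∘ₗ TensorProduct.map (antipode k) LinearMap.id ∘ₗ comul

/-- The copivotal form `w(x) = v(x') ν(x'')`. -/
noncomputable def w : A →ₗ[k] k := conv C.drinfeld C.nu

/-- The convolution inverse `w̄ = w ∘ S` of the copivotal form. -/
noncomputable def wbar : A →ₗ[k] k := C.w ∘ₗ antipode k

/-- A dual quantum trace `t` is `S`-compatible if `w̄(t') S(t'') = w̄(t') t''`. -/
def IsSCompatible (t : A) : Prop :=
  TensorProduct.lid k A (TensorProduct.map C.wbar (antipode k) (comul t)) =
    TensorProduct.lid k A (TensorProduct.map C.wbar LinearMap.id (comul t))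

end CoribbonStructure

end Coribbon

/-! ## Unimodular and ribbon Hopf algebras -/

section Ribbon

variable (k H : Type*) [Field k] [Ring H] [HopfAlgebra k H]

/-- A Hopf algebra is unimodular if its left- and right-integrals coincide. -/
def IsUnimodular : Prop := ∀ l : H, IsLeftIntegral k l ↔ IsRightIntegral k l

/-- A ribbon structure on a Hopf algebra `H`: a universal `R`-matrix `R = ∑ a ⊗ b` and a ribbon
element `v`. -/
structure RibbonStructure where
  /-- the universal `R`-matrix -/
  R : (H ⊗[k] H)ˣ
  /-- the ribbon element -/
  v : H
  /-- `R Δ(x) = Δᵒᵖ(x) R` -/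
  R_mul_comul : ∀ x : H,
    (R : H ⊗[k] H) * comul x = TensorProduct.comm k H H (comul x) * (R : H ⊗[k] H)
  /-- `(Δ ⊗ id) R = R₁₃ R₂₃` -/
  comul_rTensor :
    LinearMap.rTensor H comul (R : H ⊗[k] H) =
      LinearMap.rTensor H ((TensorProduct.mk k H H).flip 1) (R : H ⊗[k] H) *
        LinearMap.rTensor H (TensorProduct.mk k H H 1) (R : H ⊗[k] H)
  /-- `(id ⊗ Δ) R = R₁₃ R₁₂` -/
  comul_lTensor :
    LinearMap.lTensor H comul (R : H ⊗[k] H) =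
      LinearMap.lTensor H (TensorProduct.mk k H H 1) (R : H ⊗[k] H) *
        LinearMap.lTensor H ((TensorProduct.mk k H H).flip 1) (R : H ⊗[k] H)
  v_central : ∀ x : H, v * x = x * v
  /-- `v² = u S(u)` for the Drinfel'd element `u = ∑ S(b) a` -/
  v_sq :
    v * v =
      LinearMap.mul' k H (TensorProduct.map (antipode k) LinearMap.id
          (TensorProduct.comm k H H (R : H ⊗[k] H))) *
        antipode k (LinearMap.mul' k H (TensorProduct.map (antipode k) LinearMap.id
          (TensorProduct.comm k H H (R : H ⊗[k] H))))
  antipode_v : antipode k v = v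
  counit_v : counit (R := k) v = 1
  /-- `(R₂₁ R) Δ(v) = v ⊗ v` -/
  comul_v : TensorProduct.comm k H H (R : H ⊗[k] H) * (R : H ⊗[k] H) * comul v = v ⊗ₜ[k] v

variable {k H}

/-- The Drinfel'd element `u = ∑ S(b) a`, where `R = ∑ a ⊗ b`. -/
noncomputable def RibbonStructure.u (X : RibbonStructure k H) : H :=
  LinearMap.mul' k H (TensorProduct.map (antipode k) LinearMap.id
    (TensorProduct.comm k H H (X.R : H ⊗[k] H)))

/-- The inverse `v⁻¹` of the ribbon element (which is invertible in the finite-dimensional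
case). -/
noncomputable def RibbonStructure.vInv (X : RibbonStructure k H) : H := Ring.inverse X.v

/-- The pivotal group-like element `G = u v⁻¹`. -/
noncomputable def RibbonStructure.G (X : RibbonStructure k H) : H := X.u * X.vInv

/-- A right integral for `H` in the dual algebra (a right-cointegral of `H`): a linear form `λ`
with `λ(x') x'' = λ(x) 1` for all `x`. -/
def IsRightCointegral (lam : H →ₗ[k] k) : Prop :=
  ∀ x : H, TensorProduct.lid k H (LinearMap.rTensor H lam (comul x)) = lam x • (1 : H)

end Ribbon

/-! ## Framed link diagrams

A framed link in `S³` is presented by a plane diagram with blackboard framing, in general position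
with respect to the height function, and read from top to bottom as a sequence of slices. -/

/-- An elementary slice of a link diagram. The strands that meet a horizontal level are numbered
from left to right, starting with `0`. -/
inductive Slice
  /-- a local maximum, whose two legs become the strands `i` and `i + 1` below it -/
  | cap (i : ℕ)
  /-- a local minimum, which joins the strands `i` and `i + 1` above it -/
  | cup (i : ℕ)
  /-- a positive (right-handed) crossing of two downward strands at the positions `i` and `i + 1`:
  the overcrossing strand runs from the upper right to the lower left -/
  | pos (i : ℕ)
  /-- a negative (left-handed) crossing of two downward strands at the positions `i` and `i + 1`:
  the overcrossing strand runs from the upper left to the lower right -/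
  | neg (i : ℕ)

namespace Slice

/-- The slice can be attached below `n` strands. -/
def Fits : Slice → ℕ → Prop
  | cap i, n => i ≤ n
  | cup i, n => i + 2 ≤ n
  | pos i, n => i + 2 ≤ n
  | neg i, n => i + 2 ≤ n

/-- The number of strands below a slice that has `n` strands above it. -/
def below : Slice → ℕ → ℕ
  | cap _, n => n + 2
  | cup _, n => n - 2
  | pos _, n => n
  | neg _, n => n

/-- The sign of a crossing when both of its strands point downward (`0` if the slice is not a
crossing). -/
def sign : Slice → ℤ
  | pos _ => 1
  | neg _ => -1
  | _ => 0

end Slice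

/-- A link diagram: a list of slices, from top to bottom. -/
structure LinkDiagram where
  /-- the slices -/
  slices : List Slice
  fits : ∀ (t : ℕ) (s : Slice), slices[t]? = some s →
    s.Fits ((slices.take t).foldl (fun n s => s.below n) 0)
  closed : slices.foldl (fun n s => s.below n) 0 = 0

/-- A point of a link diagram at one of the levels between the slices (level `t` is just above the
slice number `t`), with a vertical direction. -/
structure DPoint where
  /-- the level -/
  level : ℕ
  /-- the number of the strand -/
  pos : ℕ
  /-- the direction: `true` for downward, `false` for upward -/
  down : Bool

/-- What is met on the way from a directed point to the next one. -/
inductive Event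
  /-- nothing -/
  | plain
  /-- a local maximum, passed from left to right -/
  | maxRight
  /-- a local maximum, passed from right to left -/
  | maxLeft
  /-- a local minimum, passed from left to right -/
  | minRight
  /-- a local minimum, passed from right to left -/
  | minLeft
  /-- the crossing in the slice `t`, passed on the overcrossing or the undercrossing strand, in
  downward or in upward direction -/
  | crossing (t : ℕ) (isOver down : Bool)

namespace LinkDiagram

variable (D : LinkDiagram)

/-- The number of strands at level `t`. -/
def width (t : ℕ) : ℕ := (D.slices.take t).foldl (fun n s => s.below n) 0

/-- The next directed point when following the link, together with what is met on the way. (The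
last case of either direction does not occur for a point of the diagram.) -/
def step : DPoint → DPoint × Event
  | ⟨t, j, true⟩ =>
    match D.slices[t]? with
    | some (.cap i) => (⟨t + 1, if j < i then j else j + 2, true⟩, .plain)
    | some (.cup i) =>
      if j < i then (⟨t + 1, j, true⟩, .plain)
      else if j = i then (⟨t, i + 1, false⟩, .minRight)
      else if j = i + 1 then (⟨t, i, false⟩, .minLeft)
      else (⟨t + 1, j - 2, true⟩, .plain)
    | some (.pos i) =>
      if j = i then (⟨t + 1, i + 1, true⟩, .crossing t false true)
      else if j = i + 1 then (⟨t + 1, i, true⟩, .crossing t true true)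
      else (⟨t + 1, j, true⟩, .plain)
    | some (.neg i) =>
      if j = i then (⟨t + 1, i + 1, true⟩, .crossing t true true)
      else if j = i + 1 then (⟨t + 1, i, true⟩, .crossing t false true)
      else (⟨t + 1, j, true⟩, .plain)
    | none => (⟨t, j, true⟩, .plain)
  | ⟨t + 1, j, false⟩ =>
    match D.slices[t]? with
    | some (.cap i) =>
      if j < i then (⟨t, j, false⟩, .plain)
      else if j = i then (⟨t + 1, i + 1, true⟩, .maxRight)
      else if j = i + 1 then (⟨t + 1, i, true⟩, .maxLeft)
      else (⟨t, j - 2, false⟩, .plain)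
    | some (.cup i) => (⟨t, if j < i then j else j + 2, false⟩, .plain)
    | some (.pos i) =>
      if j = i then (⟨t, i + 1, false⟩, .crossing t true false)
      else if j = i + 1 then (⟨t, i, false⟩, .crossing t false false)
      else (⟨t, j, false⟩, .plain)
    | some (.neg i) =>
      if j = i then (⟨t, i + 1, false⟩, .crossing t false false)
      else if j = i + 1 then (⟨t, i, false⟩, .crossing t true false)
      else (⟨t, j, false⟩, .plain)
    | none => (⟨t + 1, j, false⟩, .plain)
  | ⟨0, j, false⟩ => (⟨0, j, false⟩, .plain)

/-- The next directed point. -/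
def next (p : DPoint) : DPoint := (D.step p).1

/-- The sign of the crossing in the slice `t` when both of its strands point downward (`0` if the
slice `t` is not a crossing). -/
def sign (t : ℕ) : ℤ := (D.slices[t]?.map Slice.sign).getD 0

/-- The slices that are crossings. -/
def crossings : Finset ℕ := (Finset.range D.slices.length).filter fun t => D.sign t ≠ 0

/-- A choice of a numbering of the components of the link, and on each component of an orientation
and a base point on a strand where the component runs upward. The component number `i` runs through
the directed points `next^[n] (start i)` for `n < len i`; every point of the diagram is met exactly
once. -/
structure Traversal where
  /-- the number of components -/
  m : ℕ
  /-- the base points -/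
  start : Fin m → DPoint
  /-- the numbers of points of the components -/
  len : Fin m → ℕ
  len_pos : ∀ i, 0 < len i
  start_up : ∀ i, (start i).down = false
  start_mem : ∀ i, (start i).pos < D.width (start i).level
  periodic : ∀ i, D.next^[len i] (start i) = start i
  cover : ∀ t j, j < D.width t →
    ∃! p : (i : Fin m) × Fin (len i),
      (D.next^[(p.2 : ℕ)] (start p.1)).level = t ∧ (D.next^[(p.2 : ℕ)] (start p.1)).pos = j

variable {D}

/-- The events met on the component number `i`, in the order of travel from the base point. -/
def Traversal.events (T : D.Traversal) (i : Fin T.m) : List Event :=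
  (List.range (T.len i)).map fun n => (D.step (D.next^[n] (T.start i))).2

/-- The direction (`1` for downward, `-1` for upward) in which the component number `i` passes
through the overcrossing or undercrossing strand of the crossing `t`, and `0` if it does not. -/
def Traversal.dir (T : D.Traversal) (i : Fin T.m) (t : ℕ) (isOver : Bool) : ℤ :=
  ((T.events i).map fun e =>
    match e with
    | .crossing t' isOver' down => if t' = t ∧ isOver' = isOver then (if down then 1 else -1) else 0
    | _ => 0).sum

/-- The linking matrix, with the framing numbers (the writhes) on its diagonal. -/
noncomputable def Traversal.linkingMatrix (T : D.Traversal) : Matrix (Fin T.m) (Fin T.m) ℝ :=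
  Matrix.of fun i j => (1 / 2 : ℝ) * ∑ t ∈ D.crossings,
    ((D.sign t * (T.dir i t true * T.dir j t false + T.dir j t true * T.dir i t false) : ℤ) : ℝ)

/-- The signature of the linking matrix. -/
noncomputable def Traversal.signature (T : D.Traversal) : ℤ :=
  (sigPos T.linkingMatrix.toQuadraticForm' : ℤ) - (sigNeg T.linkingMatrix.toQuadraticForm' : ℤ)

/-- Given a pair of indices at each crossing, the element of the family `B` whose index is the first
one of the pair on the overcrossing strand and the second one on the undercrossing strand. -/
def pick {ι M : Type*} (s : D.crossings → ι × ι) (B : ι → M) (dflt : M) (t : ℕ) (isOver : Bool) : M :=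
  if h : t ∈ D.crossings then B (if isOver then (s ⟨t, h⟩).1 else (s ⟨t, h⟩).2) else dflt

end LinkDiagram

/-! ## The generalized Hennings-Kauffman-Radford evaluation for a coribbon Hopf algebra

The components of the link are labeled with a formal finite-dimensional right comodule `𝒳` with
matrix coefficients `c_{pq}`, `Δ(c_{pq}) = ∑ c_{pl} ⊗ c_{lq}`. In the ribbon category of comodules,
downward strands are labeled with `𝒳` and upward strands with `𝒳*`, on which the coaction is
`θ ↦ (v ↦ θ(v₀) ⊗ S(v₁))`. The diagram is composed of
* negative crossings `σ(v ⊗ w) = w₀ ⊗ v₀ r(w₁ ⊗ v₁)`, where `w` is on the undercrossing strand,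
* positive crossings `σ⁻¹(w ⊗ v) = v₀ ⊗ w₀ r̄(w₁ ⊗ v₁)`, where `w` is on the undercrossing strand,
* the left evaluation and coevaluation (minima and maxima passed to the left), which are those of
  vector spaces, and the right evaluation and coevaluation (minima and maxima passed to the right),
  which in addition involve the copivotal form `w` and its inverse `w̄`, respectively.

Expanding `r` and `r̄` into products of linear forms, each event on a component gives a linear form
on `A`. Since `(g ∘ f)(c) = (g ⋆ f)(c)` for the endomorphisms of `𝒳` given by linear forms `f`, `g`,
a component contributes the value on the dual character `χ = ∑ c_{pp}` of the convolution product
of these forms, later ones to the left of earlier ones. Here `χ = w̄(T') T''` for the dual quantum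
character `T` of `𝒳`, and the evaluation is obtained by replacing `T` with `ℓ`. -/

namespace CoribbonStructure

variable {k A : Type*} [Field k] [Ring A] [HopfAlgebra k A] (C : CoribbonStructure k A)

/-- The linear form given by an event, if `f t isOver` are the linear forms on the strands of the
crossings. -/
noncomputable def eventForm (f : ℕ → Bool → (A →ₗ[k] k)) : Event → (A →ₗ[k] k)
  | .crossing t isOver true => f t isOver
  | .crossing t isOver false => f t isOver ∘ₗ antipode k
  | .minRight => C.w
  | .maxRight => C.wbar
  | _ => counit

/-- The convolution product of the linear forms of a list of events, later ones to the left. -/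
noncomputable def wordForm (f : ℕ → Bool → (A →ₗ[k] k)) (es : List Event) : A →ₗ[k] k :=
  es.foldl (fun F e => conv (C.eventForm f e) F) counit

/-- The dual trace `χ = w̄(ℓ') ℓ''`. -/
noncomputable def dualTrace (l : A) : A :=
  TensorProduct.lid k A (TensorProduct.map C.wbar LinearMap.id (comul l))

variable [FiniteDimensional k A]

/-- The generalized Hennings-Kauffman-Radford evaluation of a link diagram with respect to the
`S`-compatible dual quantum trace `l`. -/
noncomputable def hkrEvaluation (l : A) {D : LinkDiagram} (T : D.Traversal) : k :=
  let b := Module.finBasis k A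
  ∑ s : D.crossings → Fin (Module.finrank k A) × Fin (Module.finrank k A),
    (∏ c : D.crossings,
      (if D.sign c = -1 then C.r else C.rbar) (b (s c).2 ⊗ₜ[k] b (s c).1)) *
    ∏ i : Fin T.m,
      C.wordForm (LinkDiagram.pick s (fun p => b.coord p) 0) (T.events i) (C.dualTrace l)

/-- The invariant `I(M_L) = β^σ γ^(-σ-m-1) ⟨L⟩_ℓ` of the 3-manifold `M_L` given by surgery along
the framed link `L`. -/
noncomputable def invariantI (l : A) (β γ : k) {D : LinkDiagram} (T : D.Traversal) : k :=
  β ^ T.signature * γ ^ (-T.signature - (T.m : ℤ) - 1) * C.hkrEvaluation l T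

end CoribbonStructure

/-! ## The Kauffman-Radford invariant of a ribbon Hopf algebra

Beads are placed on the strands of the diagram: at a negative crossing, the legs of `R = ∑ a ⊗ b`
with `a` on the overcrossing and `b` on the undercrossing strand, and at a positive crossing the
legs of `R⁻¹` in the same way. On each component, the beads are slid back to the base point, on a
vertical strand that is traversed upward, and they are multiplied in the upward order there, a bead
met later standing to the left of a bead met earlier. Sliding a bead counterclockwise through an
extremum applies `S`, and sliding it clockwise applies `S⁻¹`. A component with Whitney degree `d`
and product of beads `y` contributes `tr(G^d y)` where `tr(x) = λ(G x)`. -/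

/-- Integer powers of an invertible element. -/
noncomputable def intPow {M : Type*} [MonoidWithZero M] (x : M) : ℤ → M
  | Int.ofNat n => x ^ n
  | Int.negSucc n => Ring.inverse x ^ (n + 1)

namespace RibbonStructure

variable {k H : Type*} [Field k] [Ring H] [HopfAlgebra k H] (X : RibbonStructure k H)

/-- Slide the beads of a list of events back to the base point. The state is the number of
counterclockwise half turns of the tangent so far, together with the product so far. -/
noncomputable def slide (f : ℕ → Bool → H) (st : ℤ × H) : Event → ℤ × H
  | .crossing t isOver _ => (st.1, (intPow (antipode k : Module.End k H) (-st.1) (f t isOver)) * st.2)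
  | .maxLeft => (st.1 + 1, st.2)
  | .minRight => (st.1 + 1, st.2)
  | .maxRight => (st.1 - 1, st.2)
  | .minLeft => (st.1 - 1, st.2)
  | .plain => st

/-- The contribution `tr(G^d y)` of a component, `tr(x) = λ(G x)`. The Whitney degree `d` is half
the total number of counterclockwise half turns. -/
noncomputable def componentTrace (lam : H →ₗ[k] k) (f : ℕ → Bool → H) (es : List Event) : k :=
  let st := es.foldl (slide (k := k) f) (0, 1)
  lam (X.G * (intPow X.G (st.1 / 2) * st.2))

variable [FiniteDimensional k H]

/-- The Kauffman-Radford evaluation `TR(K)` of a link diagram with respect to a right integral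
`λ`. -/
noncomputable def krTR (lam : H →ₗ[k] k) {D : LinkDiagram} (T : D.Traversal) : k :=
  let b := Module.finBasis k H
  ∑ s : D.crossings → Fin (Module.finrank k H) × Fin (Module.finrank k H),
    (∏ c : D.crossings,
      (b.tensorProduct b).repr
        (if D.sign c = -1 then (X.R : H ⊗[k] H) else ((X.R⁻¹ : (H ⊗[k] H)ˣ) : H ⊗[k] H))
        ((s c).1, (s c).2)) *
    ∏ i : Fin T.m, X.componentTrace lam (LinkDiagram.pick s (fun p => b p) 0) (T.events i)

/-- The Kauffman-Radford invariant
`INV(K) = [λ(v) λ(v⁻¹)]^(-m/2) [λ(v) / λ(v⁻¹)]^(-σ/2) TR(K)`, where `p` and `q` are the chosen square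
roots of `λ(v) λ(v⁻¹)` and of `λ(v) / λ(v⁻¹)`, `m` is the number of components of the framed link
`K`, and `σ` the signature of its linking matrix. -/
noncomputable def krINV (lam : H →ₗ[k] k) (p q : k) {D : LinkDiagram} (T : D.Traversal) : k :=
  p ^ (-(T.m : ℤ)) * q ^ (-T.signature) * X.krTR lam T

end RibbonStructure

/-! Evaluation identifies `H` with the linear forms on `H*` and turns products into convolution
products in the reversed order (`conv_ev`, `conv_ev₂`). The axioms of a ribbon structure on `H`
thereby become those of a coribbon structure on `H*` (`dual`), in which `ν`, `w` and `w̄` are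
evaluation at `v⁻¹`, `G⁻¹` and `G`.

The left-integrals of `H*` are the right-cointegrals `λ` of `H`. A nonzero one exists because
averaging any linear form gives a right-cointegral, and the form can be recovered from such averages
(`conv_averaged`, `sum_averaged`). A nonzero `λ` is nondegenerate, so there is a right integral `Λ`
with `λ(Λ) = 1`; unimodularity makes it two-sided. Its dual-basis formulas give uniqueness of `λ`,
the twisted symmetry `λ(xy) = λ(S²(y)x)`, which is the dual quantum trace property, and `λ(S(x)) =
λ(gx)` with `g = ∑ λ(Λ'')Λ'`. Applying `id ⊗ λ` to `R Δ(Λ) = Δᵒᵖ(Λ) R` gives `S(u) g = u`, that is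
`g = G²`. Hence `λ(G S(x)) = λ(G x)` (`apply_G_antipode`), which is `S`-compatibility.

Both link evaluations sum over expansions of `R` and `R⁻¹`. Every strand of every crossing is passed
exactly once, so the product over the components is multilinear in the beads and any expansion may
be used (`krTR_eq`). For fixed beads, the coribbon side multiplies in `H`, in the order of travel,
`b` or `S(b)` at a crossing passed downward or upward, and `G⁻¹` or `G` at a minimum or maximum
passed to the right. Since `S²` is conjugation by `G`, induction along the component (`word_eq`)
shows that this word is `S(y) G^(-⌊n/2⌋)`, where `y` is the product of the slid beads and `n` the
number of counterclockwise half turns. With `d = n/2` at the end, the dual trace yields `λ(S(y)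
G^(-d) G) = λ(G S(G^d y)) = λ(G G^d y) = tr(G^d y)`. Only powers of `β` and `γ` remain to be
compared. -/

section Conv

/-! ### Convolution of linear maps -/

variable {k C B : Type*} [Field k] [AddCommGroup C] [Module k C] [Coalgebra k C]
  [Ring B] [Algebra k B]

theorem conv_eq_ofConv_mul (f g : C →ₗ[k] B) :
    conv f g = (WithConv.toConv f * WithConv.toConv g).ofConv := rfl

theorem conv_apply {ι : Type*} (f g : C →ₗ[k] B) {c : C} (ρ : Coalgebra.Repr k c ι) :
    conv f g c = ∑ i ∈ ρ.index, f (ρ.left i) * g (ρ.right i) := by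
  simp [conv, ← ρ.eq]

theorem conv_counit (f : C →ₗ[k] k) : conv f counit = f :=
  congrArg WithConv.ofConv (mul_one (WithConv.toConv f))

theorem sum_smul_counit {ι : Type*} {x : C} (ρ : Coalgebra.Repr k x ι) :
    ∑ i ∈ ρ.index, counit (R := k) (ρ.right i) • ρ.left i = x := by
  have h := congrArg (TensorProduct.rid k C) (sum_tmul_counit_eq (R := k) ρ)
  rw [map_sum] at h
  simpa only [TensorProduct.rid_tmul, one_smul] using h

/-- The antipode is a two-sided convolution inverse of the identity, so `f ⋆ id` determines `f`. -/
theorem eq_of_conv_id {H : Type*} [Ring H] [HopfAlgebra k H] {f g : H →ₗ[k] H}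
    (h : conv f LinearMap.id = g) : f = conv g (antipode k) := by
  have := congrArg (fun x => (WithConv.toConv x * WithConv.toConv (antipode k)).ofConv) h
  simp only [conv_eq_ofConv_mul, WithConv.toConv_ofConv, mul_assoc, LinearMap.id_mul_antipode,
    mul_one] at this
  exact this

theorem eq_of_conv_antipode {H : Type*} [Ring H] [HopfAlgebra k H] {f g : H →ₗ[k] H}
    (h : conv f (antipode k) = g) : f = conv g LinearMap.id := by
  have := congrArg (fun x => (WithConv.toConv x * WithConv.toConv LinearMap.id).ofConv) h
  simp only [conv_eq_ofConv_mul, WithConv.toConv_ofConv, mul_assoc, LinearMap.antipode_mul_id,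
    mul_one] at this
  exact this

theorem eq_of_id_conv {H : Type*} [Ring H] [HopfAlgebra k H] {f g : H →ₗ[k] H}
    (h : conv LinearMap.id f = g) : f = conv (antipode k) g := by
  have := congrArg (fun x => (WithConv.toConv (antipode k) * WithConv.toConv x).ofConv) h
  simp only [conv_eq_ofConv_mul, WithConv.toConv_ofConv, ← mul_assoc, LinearMap.antipode_mul_id,
    one_mul] at this
  exact this

end Conv

/-! ### Elements of `H` and `H ⊗ H` as linear forms on the dual -/

namespace DualHopf

variable {k H : Type*} [Field k] [Ring H] [HopfAlgebra k H]

/-- The linear form `φ ↦ φ(x)` on `H*`, as a linear function of `x`. -/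
def ev : H →ₗ[k] (DualHopf k H →ₗ[k] k) := toForm.toLinearMap.flip

@[simp] theorem ev_apply (x : H) (φ : DualHopf k H) : ev x φ = toForm φ x := rfl

theorem mul'_map_ev (x y : H) (t : DualHopf k H ⊗[k] DualHopf k H) :
    LinearMap.mul' k k (TensorProduct.map (ev x) (ev y) t) = toForm (evalLeft x t) y := by
  induction t using TensorProduct.induction_on with
  | zero => simp
  | tmul φ ψ => simp
  | add a b ha hb => simp only [map_add, ha, hb, LinearMap.add_apply]

/-- The linear form `φ ⊗ ψ ↦ φ(x) ψ(y)` on `H* ⊗ H*`, as a linear function of `x ⊗ y`. -/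
noncomputable def ev₂ : H ⊗[k] H →ₗ[k] (DualHopf k H ⊗[k] DualHopf k H →ₗ[k] k) :=
  TensorProduct.lift (LinearMap.mk₂ k
    (fun x y => LinearMap.mul' k k ∘ₗ TensorProduct.map (ev x) (ev y))
    (fun _ _ _ => by simp [TensorProduct.map_add_left, LinearMap.comp_add])
    (fun _ _ _ => by simp [TensorProduct.map_smul_left, LinearMap.comp_smul])
    (fun _ _ _ => by simp [TensorProduct.map_add_right, LinearMap.comp_add])
    (fun _ _ _ => by simp [TensorProduct.map_smul_right, LinearMap.comp_smul]))

@[simp] theorem ev₂_tmul (x y : H) (φ ψ : DualHopf k H) :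
    ev₂ (x ⊗ₜ[k] y) (φ ⊗ₜ[k] ψ) = toForm φ x * toForm ψ y := by
  simp [ev₂]

theorem ev₂_apply (t : H ⊗[k] H) (φ ψ : DualHopf k H) :
    ev₂ t (φ ⊗ₜ[k] ψ) = LinearMap.mul' k k (TensorProduct.map φ.toForm ψ.toForm t) := by
  induction t using TensorProduct.induction_on with
  | zero => simp
  | tmul x y => simp
  | add a b ha hb => simp only [map_add, LinearMap.add_apply, ha, hb]

theorem ev₂_comm (t : H ⊗[k] H) :
    ev₂ (TensorProduct.comm k H H t) =
      ev₂ t ∘ₗ (TensorProduct.comm k (DualHopf k H) (DualHopf k H)).toLinearMap := by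
  refine TensorProduct.ext' fun φ ψ => ?_
  induction t using TensorProduct.induction_on with
  | zero => simp
  | tmul x y => simp [mul_comm]
  | add a b ha hb => simp only [map_add, LinearMap.add_comp, LinearMap.add_apply, ha, hb]

theorem map_ev_ev (x y : H) :
    LinearMap.mul' k k ∘ₗ TensorProduct.map (ev x) (ev y) = ev₂ (x ⊗ₜ[k] y) :=
  TensorProduct.ext' fun φ ψ => by simp

theorem toForm_mul_apply (φ ψ : DualHopf k H) (x : H) :
    toForm (φ * ψ) x = ev₂ (comul x) (ψ ⊗ₜ φ) := by
  rw [ev₂_apply]; rfl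

theorem ev_comp_mul' (x : H) :
    ev x ∘ₗ LinearMap.mul' k (DualHopf k H) = ev₂ (TensorProduct.comm k H H (comul x)) :=
  TensorProduct.ext' fun φ ψ => by simp [toForm_mul_apply, ev₂_comm]

theorem ev_comp_conv_linearMap {C : Type*} [AddCommGroup C] [Module k C] [Coalgebra k C]
    (F : C →ₗ[k] DualHopf k H) (r : C →ₗ[k] k) (x : H) :
    ev x ∘ₗ conv F (Algebra.linearMap k _ ∘ₗ r) = conv (ev x ∘ₗ F) r := by
  ext c
  rw [LinearMap.comp_apply, conv_apply _ _ (ℛ k c), conv_apply _ _ (ℛ k c), map_sum]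
  refine Finset.sum_congr rfl fun i _ => ?_
  simp [← Algebra.commutes, ← Algebra.smul_def, mul_comm]

theorem ev_comp_linearMap_conv {C : Type*} [AddCommGroup C] [Module k C] [Coalgebra k C]
    (F : C →ₗ[k] DualHopf k H) (r : C →ₗ[k] k) (x : H) :
    ev x ∘ₗ conv (Algebra.linearMap k _ ∘ₗ r) F = conv r (ev x ∘ₗ F) := by
  ext c
  rw [LinearMap.comp_apply, conv_apply _ _ (ℛ k c), conv_apply _ _ (ℛ k c), map_sum]
  refine Finset.sum_congr rfl fun i _ => ?_
  simp [← Algebra.smul_def]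

theorem hom_ext_ev {C : Type*} [AddCommGroup C] [Module k C] {F G : C →ₗ[k] DualHopf k H}
    (h : ∀ x, ev x ∘ₗ F = ev x ∘ₗ G) : F = G :=
  LinearMap.ext fun c => ext_toForm fun x => LinearMap.congr_fun (h x) c

variable [FiniteDimensional k H]

theorem ev_bijective : Function.Bijective (ev : H →ₗ[k] (DualHopf k H →ₗ[k] k)) :=
  Module.bijective_dual_eval k H

/-- The order is reversed because the coproduct of `H*` is `φ'(y) φ''(x) = φ(xy)`. -/
theorem conv_ev (x y : H) : conv (ev x) (ev y) = ev (k := k) (y * x) := by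
  ext φ
  rw [conv, LinearMap.comp_apply, LinearMap.comp_apply, mul'_map_ev, comul_eq, evalLeft_comulDual]
  simp

theorem counit_eq_ev : (counit : DualHopf k H →ₗ[k] k) = ev 1 := rfl

theorem ev_comp_antipode (x : H) : ev x ∘ₗ antipode k = ev (k := k) (antipode k x) := rfl

theorem conv_ev₂ (s t : H ⊗[k] H) : conv (ev₂ s) (ev₂ t) = ev₂ (k := k) (t * s) := by
  induction s using TensorProduct.induction_on with
  | zero => simp [conv]
  | add a b ha hb =>
    rw [map_add, mul_add, map_add, ← ha, ← hb]
    simp [conv, TensorProduct.map_add_left, LinearMap.comp_add, LinearMap.add_comp]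
  | tmul x y =>
    induction t using TensorProduct.induction_on with
    | zero => simp [conv]
    | add a b ha hb =>
      rw [map_add, add_mul, map_add, ← ha, ← hb]
      simp [conv, TensorProduct.map_add_right, LinearMap.comp_add, LinearMap.add_comp]
    | tmul z w =>
      refine TensorProduct.ext' fun φ ψ => ?_
      rw [conv_apply _ _ ((ℛ k φ).tmul (ℛ k ψ)), Algebra.TensorProduct.tmul_mul_tmul, ev₂_tmul,
        ← ev_apply, ← ev_apply (w * y), ← conv_ev, ← conv_ev, conv_apply _ _ (ℛ k φ),
        conv_apply _ _ (ℛ k ψ), Finset.sum_mul_sum, ← Finset.sum_product']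
      refine Finset.sum_congr rfl fun i _ => ?_
      simp only [Coalgebra.Repr.tmul, ev₂_tmul, ev_apply]
      ring

/-- The antipode is a coalgebra antihomomorphism, tested on linear forms. -/
theorem ev₂_comul_antipode (x : H) (φ ψ : DualHopf k H) :
    ev₂ (comul (antipode k x)) (ψ ⊗ₜ φ) = ev₂ (comul x) (antipode k φ ⊗ₜ antipode k ψ) := by
  rw [← toForm_mul_apply, ← toForm_mul_apply, ← antipode_mul_antidistrib]
  rfl

end DualHopf

/-! ### The ribbon element, the Drinfel'd element and the pivotal element -/

namespace RibbonStructure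

variable {k H : Type*} [Field k] [Ring H] [HopfAlgebra k H] (X : RibbonStructure k H)

theorem v_commute (x : H) : Commute X.v x := X.v_central x

/-- `R₂₁ R` as a unit. -/
noncomputable def monodromy : (H ⊗[k] H)ˣ :=
  Units.map (Algebra.TensorProduct.comm k H H : H ⊗[k] H →* H ⊗[k] H) X.R * X.R

theorem comm_eq (t : H ⊗[k] H) :
    TensorProduct.comm k H H t = Algebra.TensorProduct.comm k H H t := rfl

theorem comm_mul (s t : H ⊗[k] H) : TensorProduct.comm k H H (s * t) =
    TensorProduct.comm k H H s * TensorProduct.comm k H H t := by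
  simp only [comm_eq, map_mul]

theorem monodromy_mul_comul_v :
    (X.monodromy : H ⊗[k] H) * comul X.v = X.v ⊗ₜ[k] X.v := X.comul_v

theorem mul_antipode_of_mul_comul_v (q : H ⊗[k] H) :
    LinearMap.mul' k H ((antipode k).rTensor H (q * X.v ⊗ₜ[k] X.v)) =
      X.v * (LinearMap.mul' k H ((antipode k).rTensor H q) * X.v) := by
  induction q using TensorProduct.induction_on with
  | zero => simp
  | tmul a b => simp [antipode_mul_antidistrib, X.antipode_v, mul_assoc]
  | add a b ha hb => simp only [add_mul, mul_add, map_add, ha, hb]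

/-- Write `Δ(v) = q (v ⊗ v)` with `q` the inverse of `R₂₁R`. The antipode axiom and `S(v) = v` turn
`ε(v) = 1` into `v · (∑ S(q₁) q₂) v = 1`, and centrality of `v` makes this inverse two-sided. -/
theorem isUnit_v : IsUnit X.v := by
  have h : comul X.v = ((X.monodromy⁻¹ : (H ⊗[k] H)ˣ) : H ⊗[k] H) * X.v ⊗ₜ[k] X.v := by
    rw [← X.monodromy_mul_comul_v, Units.inv_mul_cancel_left]
  have h1 := mul_antipode_rTensor_comul_apply (R := k) X.v
  rw [h, mul_antipode_of_mul_comul_v, X.counit_v, map_one] at h1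
  exact isUnit_iff_exists.2 ⟨_, h1, by rw [← X.v_central]; exact h1⟩

theorem v_mul_vInv : X.v * X.vInv = 1 := Ring.mul_inverse_cancel _ X.isUnit_v

theorem vInv_mul_v : X.vInv * X.v = 1 := Ring.inverse_mul_cancel _ X.isUnit_v

theorem vInv_commute (x : H) : Commute X.vInv x := by
  rw [vInv, ← X.isUnit_v.unit_spec, Ring.inverse_unit]
  exact Commute.units_inv_left (X.v_commute x)

theorem antipode_vInv : antipode k X.vInv = X.vInv := by
  have h := congrArg (antipode k) X.v_mul_vInv
  rw [antipode_mul_antidistrib, antipode_one, X.antipode_v] at h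
  calc antipode k X.vInv = antipode k X.vInv * (X.v * X.vInv) := by rw [v_mul_vInv, mul_one]
    _ = X.vInv := by rw [← mul_assoc, h, one_mul]

theorem comul_vInv :
    comul X.vInv = (X.monodromy : H ⊗[k] H) * X.vInv ⊗ₜ[k] X.vInv := by
  have h : comul X.v * ((X.monodromy : H ⊗[k] H) * X.vInv ⊗ₜ[k] X.vInv) = 1 := by
    have h1 : (X.monodromy : H ⊗[k] H) * X.vInv ⊗ₜ[k] X.vInv =
        X.vInv ⊗ₜ[k] X.vInv * (X.monodromy : H ⊗[k] H) := by
      generalize (X.monodromy : H ⊗[k] H) = q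
      induction q using TensorProduct.induction_on with
      | zero => simp
      | tmul a b => simp [(X.vInv_commute a).eq, (X.vInv_commute b).eq]
      | add a b ha hb => simp only [add_mul, mul_add, ha, hb]
    have h2 : comul X.v = ((X.monodromy⁻¹ : (H ⊗[k] H)ˣ) : H ⊗[k] H) * X.v ⊗ₜ[k] X.v := by
      rw [← X.monodromy_mul_comul_v, Units.inv_mul_cancel_left]
    rw [h1, h2, mul_assoc, ← mul_assoc (X.v ⊗ₜ[k] X.v), Algebra.TensorProduct.tmul_mul_tmul,
      v_mul_vInv, ← Algebra.TensorProduct.one_def, one_mul, Units.inv_mul]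
  calc comul X.vInv
      = comul X.vInv * (comul X.v * ((X.monodromy : H ⊗[k] H) * X.vInv ⊗ₜ[k] X.vInv)) := by
        rw [h, mul_one]
    _ = _ := by rw [← mul_assoc, ← Bialgebra.comul_mul, vInv_mul_v, Bialgebra.comul_one, one_mul]

theorem u_mul_antipode_u : X.u * antipode k X.u = X.v * X.v := X.v_sq.symm

/-- The linear map `p ⊗ q ↦ S(q) p`. -/
noncomputable def antipodeMulOp : H ⊗[k] H →ₗ[k] H :=
  LinearMap.mul' k H ∘ₗ TensorProduct.map (antipode k) LinearMap.id ∘ₗ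
    (TensorProduct.comm k H H).toLinearMap

@[simp] theorem antipodeMulOp_tmul (p q : H) :
    antipodeMulOp (p ⊗ₜ[k] q) = antipode k q * p := by simp [antipodeMulOp]

theorem u_eq : X.u = antipodeMulOp (X.R : H ⊗[k] H) := rfl

theorem antipodeMulOp_mul_comul {ι : Type*} (t : H ⊗[k] H) {y : H} (ρ : Coalgebra.Repr k y ι) :
    antipodeMulOp (t * comul y) =
      ∑ j ∈ ρ.index, antipode k (ρ.right j) * (antipodeMulOp t * ρ.left j) := by
  induction t using TensorProduct.induction_on with
  | zero => simp
  | tmul a b => simp [← ρ.eq, Finset.mul_sum, antipode_mul_antidistrib, mul_assoc]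
  | add a b ha hb => simp only [add_mul, mul_add, map_add, ha, hb, Finset.sum_add_distrib]

theorem antipodeMulOp_comul_mul (t : H ⊗[k] H) (y : H) :
    antipodeMulOp (TensorProduct.comm k H H (comul y) * t) = counit (R := k) y • antipodeMulOp t := by
  induction t using TensorProduct.induction_on with
  | zero => simp
  | tmul a b =>
    have h : counit (R := k) y • antipodeMulOp (a ⊗ₜ[k] b) =
        antipode k b * ((counit (R := k) y • 1) * a) := by simp
    rw [h, ← sum_antipode_mul_eq_smul (ℛ k y)]
    nth_rw 1 [← (ℛ k y).eq]
    simp [Finset.mul_sum, Finset.sum_mul, antipode_mul_antidistrib, mul_assoc]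
  | add a b ha hb => simp only [mul_add, map_add, ha, hb, smul_add]

/-- Drinfel'd's argument: `R Δ(y) = Δᵒᵖ(y) R` gives `∑ S(y'') u y' = ε(y) u`. In `∑ S²(x''') S(x'')
u x'`, contracting the first two tensor factors by this identity leaves `S²(x) u`, while contracting
the last two by `S²(x''') S(x'') = S(x'' S(x'''))` leaves `u x`. -/
theorem antipode_sq_mul_u (x : H) : antipode k (antipode k x) * X.u = X.u * x := by
  let F : H ⊗[k] (H ⊗[k] H) →ₗ[k] H := LinearMap.mul' k H ∘ₗ
    (TensorProduct.comm k H H).toLinearMap ∘ₗ TensorProduct.map (LinearMap.mulLeft k X.u)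
      (antipode k ∘ₗ LinearMap.mul' k H ∘ₗ LinearMap.lTensor H (antipode k))
  have hF : ∀ a b c : H, F (a ⊗ₜ (b ⊗ₜ c)) =
      antipode k (antipode k c) * (antipode k b * (X.u * a)) := fun a b c => by
    simp [F, antipode_mul_antidistrib, mul_assoc]
  have h := congrArg F (sum_tmul_tmul_eq (ℛ k x) (fun i => ℛ k ((ℛ k x).left i))
    (fun i => ℛ k ((ℛ k x).right i)))
  have h2 : ∀ a c : H, F (a ⊗ₜ comul c) = X.u * (counit (R := k) c • a) := fun a c => by
    simp [F, mul_antipode_lTensor_comul_apply, Algebra.algebraMap_eq_smul_one]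
  have hl : ∀ i, F (∑ j ∈ (ℛ k ((ℛ k x).left i)).index, (ℛ k ((ℛ k x).left i)).left j ⊗ₜ
      ((ℛ k ((ℛ k x).left i)).right j ⊗ₜ (ℛ k x).right i)) =
      antipode k (antipode k (counit (R := k) ((ℛ k x).left i) • (ℛ k x).right i)) * X.u :=
    fun i => by
      rw [map_sum]
      simp only [hF]
      rw [← Finset.mul_sum, X.u_eq, ← antipodeMulOp_mul_comul, X.R_mul_comul,
        antipodeMulOp_comul_mul, map_smul, map_smul, smul_mul_assoc, mul_smul_comm]
  have hr : ∀ i, F (∑ j ∈ (ℛ k ((ℛ k x).right i)).index, (ℛ k x).left i ⊗ₜ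
      ((ℛ k ((ℛ k x).right i)).left j ⊗ₜ (ℛ k ((ℛ k x).right i)).right j)) =
      X.u * (counit (R := k) ((ℛ k x).right i) • (ℛ k x).left i) := fun i => by
    rw [← TensorProduct.tmul_sum, (ℛ k ((ℛ k x).right i)).eq, h2]
  rw [map_sum, map_sum, Finset.sum_congr rfl fun i _ => hl i,
    Finset.sum_congr rfl fun i _ => hr i, ← Finset.sum_mul, ← map_sum, ← map_sum,
    sum_counit_smul, ← Finset.mul_sum, sum_smul_counit] at h
  exact h

variable [FiniteDimensional k H]

theorem isUnit_u : IsUnit X.u := by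
  have h : X.u * (antipode k X.u * (X.vInv * X.vInv)) = 1 := by
    rw [← mul_assoc, u_mul_antipode_u, mul_assoc, ← mul_assoc X.v X.vInv, v_mul_vInv, one_mul,
      v_mul_vInv]
  -- In a finite-dimensional algebra a one-sided inverse is two-sided.
  have : IsArtinianRing H := isArtinian_of_tower k inferInstance
  exact IsUnit.of_mul_eq_one _ h

theorem isUnit_antipode_u : IsUnit (antipode k X.u) := by
  obtain ⟨w, h1, h2⟩ := isUnit_iff_exists.1 X.isUnit_u
  refine isUnit_iff_exists.2 ⟨antipode k w, ?_, ?_⟩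
  · rw [← antipode_mul_antidistrib, h2, antipode_one]
  · rw [← antipode_mul_antidistrib, h1, antipode_one]

theorem antipode_u_commute : Commute X.u (antipode k X.u) := by
  have h1 : antipode k (antipode k X.u) = X.u := by
    refine X.isUnit_u.mul_right_cancel ?_
    rw [antipode_sq_mul_u]
  have h := X.antipode_sq_mul_u (antipode k X.u)
  rw [h1] at h
  exact h.symm

/-- The pivotal element as a unit. -/
noncomputable def GUnit : Hˣ := 
  X.isUnit_u.unit * ⟨X.vInv, X.v, X.vInv_mul_v, X.v_mul_vInv⟩

theorem coe_GUnit : (X.GUnit : H) = X.G := rfl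

theorem antipode_GUnit : antipode k (X.GUnit : H) = ((X.GUnit⁻¹ : Hˣ) : H) := by
  refine (Units.inv_eq_of_mul_eq_one_right ?_).symm
  rw [coe_GUnit, G, antipode_mul_antidistrib, antipode_vInv, mul_assoc,
    (X.vInv_commute X.u).symm.left_comm, (X.vInv_commute X.u).symm.left_comm, u_mul_antipode_u,
    ← mul_assoc X.vInv X.v, vInv_mul_v, one_mul, vInv_mul_v]

theorem antipode_sq (x : H) :
    antipode k (antipode k x) = (X.GUnit : H) * x * ((X.GUnit⁻¹ : Hˣ) : H) := by
  rw [Units.eq_mul_inv_iff_mul_eq, coe_GUnit, G, ← mul_assoc, antipode_sq_mul_u, mul_assoc,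
    mul_assoc, (X.vInv_commute x).eq]

theorem antipode_GUnit_inv : antipode k ((X.GUnit⁻¹ : Hˣ) : H) = (X.GUnit : H) := by
  rw [← antipode_GUnit, antipode_sq, Units.mul_inv_cancel_right]

/-- The antipode as a unit of the ring of endomorphisms of `H`. -/
theorem isUnit_antipode (X : RibbonStructure k H) : IsUnit (antipode k : Module.End k H) := by
  have h : Function.Injective (antipode k : Module.End k H) := by
    intro x y hxy
    have := congrArg (antipode k) hxy
    simpa [X.antipode_sq] using this
  rw [Module.End.isUnit_iff]
  exact ⟨h, LinearMap.surjective_of_injective h⟩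

end RibbonStructure

/-! ### The counit and the antipode on the universal `R`-matrix -/

namespace RibbonStructure

variable {k H : Type*} [Field k] [Ring H] [HopfAlgebra k H] (X : RibbonStructure k H)

theorem rTensor_mul_comp_antipode (s t : H ⊗[k] H) :
    LinearMap.rTensor H (LinearMap.mul' k H ∘ₗ LinearMap.rTensor H (antipode k))
      (LinearMap.rTensor H ((TensorProduct.mk k H H).flip 1) s *
        LinearMap.rTensor H (TensorProduct.mk k H H 1) t) =
      LinearMap.rTensor H (antipode k) s * t := by
  induction s using TensorProduct.induction_on with
  | zero => simp
  | add a b ha hb => simp only [add_mul, map_add, ha, hb]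
  | tmul a b =>
    induction t using TensorProduct.induction_on with
    | zero => simp
    | add a b ha hb => simp only [mul_add, map_add, ha, hb]
    | tmul c d => simp

theorem rTensor_counit_mul (s t : H ⊗[k] H) :
    LinearMap.rTensor H ((TensorProduct.lid k H).toLinearMap ∘ₗ LinearMap.rTensor H counit)
      (LinearMap.rTensor H ((TensorProduct.mk k H H).flip 1) s *
        LinearMap.rTensor H (TensorProduct.mk k H H 1) t) =
      LinearMap.rTensor H (Algebra.linearMap k H ∘ₗ counit) s * t := by
  induction s using TensorProduct.induction_on with
  | zero => simp
  | add a b ha hb => simp only [add_mul, map_add, ha, hb]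
  | tmul a b =>
    induction t using TensorProduct.induction_on with
    | zero => simp
    | add a b ha hb => simp only [mul_add, map_add, ha, hb]
    | tmul c d => simp [Algebra.smul_def]

theorem lTensor_counit_mul (s t : H ⊗[k] H) :
    LinearMap.lTensor H ((TensorProduct.lid k H).toLinearMap ∘ₗ LinearMap.rTensor H counit)
      (LinearMap.lTensor H (TensorProduct.mk k H H 1) s *
        LinearMap.lTensor H ((TensorProduct.mk k H H).flip 1) t) =
      s * LinearMap.lTensor H (Algebra.linearMap k H ∘ₗ counit) t := by
  induction s using TensorProduct.induction_on with
  | zero => simp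
  | add a b ha hb => simp only [add_mul, map_add, ha, hb]
  | tmul a b =>
    induction t using TensorProduct.induction_on with
    | zero => simp
    | add a b ha hb => simp only [mul_add, map_add, ha, hb]
    | tmul c d => simp [← Algebra.commutes, Algebra.smul_def]

theorem map_antipode_mul_comp_antipode (s t : H ⊗[k] H) :
    TensorProduct.map (antipode k) (LinearMap.mul' k H ∘ₗ LinearMap.rTensor H (antipode k))
      (LinearMap.lTensor H (TensorProduct.mk k H H 1) s *
        LinearMap.lTensor H ((TensorProduct.mk k H H).flip 1) t) =
      TensorProduct.map (antipode k) (antipode k) t * LinearMap.rTensor H (antipode k) s := by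
  induction s using TensorProduct.induction_on with
  | zero => simp
  | add a b ha hb => simp only [add_mul, mul_add, map_add, ha, hb]
  | tmul a b =>
    induction t using TensorProduct.induction_on with
    | zero => simp
    | add a b ha hb => simp only [mul_add, add_mul, map_add, ha, hb]
    | tmul c d => simp [antipode_mul_antidistrib]

/-- Applying `ε` to the first leg of `(Δ ⊗ id) R = R₁₃ R₂₃` gives `R = (ε ⊗ id)(R) R`, and `R` is
invertible. -/
theorem rTensor_counit_R :
    LinearMap.rTensor H (Algebra.linearMap k H ∘ₗ counit) (X.R : H ⊗[k] H) = 1 := by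
  have h := congrArg
    (LinearMap.rTensor H ((TensorProduct.lid k H).toLinearMap ∘ₗ LinearMap.rTensor H counit))
    X.comul_rTensor
  rw [rTensor_counit_mul, ← LinearMap.rTensor_comp_apply, LinearMap.comp_assoc,
    rTensor_counit_comp_comul] at h
  refine X.R.isUnit.mul_right_cancel (h.symm.trans ?_)
  rw [one_mul]
  convert LinearMap.rTensor_id_apply H H _
  ext; simp

theorem lTensor_counit_R :
    LinearMap.lTensor H (Algebra.linearMap k H ∘ₗ counit) (X.R : H ⊗[k] H) = 1 := by
  have h := congrArg
    (LinearMap.lTensor H ((TensorProduct.lid k H).toLinearMap ∘ₗ LinearMap.rTensor H counit))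
    X.comul_lTensor
  rw [lTensor_counit_mul, ← LinearMap.lTensor_comp_apply, LinearMap.comp_assoc,
    rTensor_counit_comp_comul] at h
  refine X.R.isUnit.mul_left_cancel (h.symm.trans ?_)
  rw [mul_one]
  convert LinearMap.lTensor_id_apply H H _
  ext; simp

/-- Contracting the first two legs of `R₁₃ R₂₃` by `a ⊗ b ↦ S(a) b` gives `(S ⊗ id)(R) R`; on `(Δ ⊗
id) R` the same contraction gives `(ε ⊗ id) R = 1`. -/
theorem rTensor_antipode_R :
    LinearMap.rTensor H (antipode k) (X.R : H ⊗[k] H) = ((X.R⁻¹ : (H ⊗[k] H)ˣ) : H ⊗[k] H) := by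
  have h := congrArg
    (LinearMap.rTensor H (LinearMap.mul' k H ∘ₗ LinearMap.rTensor H (antipode k))) X.comul_rTensor
  rw [rTensor_mul_comp_antipode, ← LinearMap.rTensor_comp_apply, LinearMap.comp_assoc,
    mul_antipode_rTensor_comul, rTensor_counit_R] at h
  exact (Units.inv_eq_of_mul_eq_one_left h.symm).symm

/-- Applying `S` to the first leg of `(id ⊗ Δ) R = R₁₃ R₁₂` and contracting the other two by `a ⊗ b
↦ S(a) b` gives `1 = (S ⊗ S)(R) · (S ⊗ id)(R)`, whose last factor is `R⁻¹`. -/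
theorem map_antipode_R :
    TensorProduct.map (antipode k) (antipode k) (X.R : H ⊗[k] H) = (X.R : H ⊗[k] H) := by
  have h := congrArg (TensorProduct.map (antipode k)
    (LinearMap.mul' k H ∘ₗ LinearMap.rTensor H (antipode k))) X.comul_lTensor
  rw [map_antipode_mul_comp_antipode, rTensor_antipode_R, ← LinearMap.comp_apply,
    LinearMap.map_comp_lTensor, LinearMap.comp_assoc,
    mul_antipode_rTensor_comul, ← LinearMap.rTensor_comp_lTensor, LinearMap.comp_apply,
    lTensor_counit_R, Algebra.TensorProduct.one_def, LinearMap.rTensor_tmul, antipode_one,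
    ← Algebra.TensorProduct.one_def] at h
  rw [← Units.mul_inv_eq_one]
  exact h.symm

/-- `∑ a S(b) = S(u)`. -/
theorem mul_lTensor_antipode_R :
    LinearMap.mul' k H (LinearMap.lTensor H (antipode k) (X.R : H ⊗[k] H)) =
      antipode k X.u := by
  have h : ∀ t : H ⊗[k] H, antipode k (antipodeMulOp t) =
      LinearMap.mul' k H (LinearMap.lTensor H (antipode k)
        (TensorProduct.map (antipode k) (antipode k) t)) := by
    intro t
    induction t using TensorProduct.induction_on with
    | zero => simp
    | add a b ha hb => simp only [map_add, ha, hb]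
    | tmul a b => simp [antipode_mul_antidistrib]
  rw [u_eq, h, map_antipode_R]

end RibbonStructure

/-! ### The coproduct axioms of `R`, tested on triples of linear forms -/

namespace DualHopf

variable {k H : Type*} [Field k] [Ring H] [HopfAlgebra k H]

theorem map_ev_comm_apply (t : H ⊗[k] H) (φ ψ : DualHopf k H) :
    ev₂ (TensorProduct.comm k H H t) (φ ⊗ₜ[k] ψ) =
      LinearMap.mul' k k (TensorProduct.map ψ.toForm φ.toForm t) := by
  rw [ev₂_comm]; simp [ev₂_apply]

/-- The linear form `x ⊗ y ⊗ z ↦ φ(x) ψ(y) χ(z)`. -/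
noncomputable def triple (φ ψ χ : DualHopf k H) : H ⊗[k] (H ⊗[k] H) →ₗ[k] k :=
  LinearMap.mul' k k ∘ₗ TensorProduct.map φ.toForm
    (LinearMap.mul' k k ∘ₗ TensorProduct.map ψ.toForm χ.toForm)

@[simp] theorem triple_tmul (φ ψ χ : DualHopf k H) (x y z : H) :
    triple φ ψ χ (x ⊗ₜ (y ⊗ₜ z)) = toForm φ x * (toForm ψ y * toForm χ z) := by simp [triple]

theorem ev₂_comm_mul_left (t : H ⊗[k] H) (φ ψ χ : DualHopf k H) :
    ev₂ (TensorProduct.comm k H H t) ((φ * ψ) ⊗ₜ χ) =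
      triple χ ψ φ (LinearMap.lTensor H comul t) := by
  induction t using TensorProduct.induction_on with
  | zero => simp
  | add a b ha hb => simp only [map_add, LinearMap.add_apply, ha, hb]
  | tmul a b =>
    simp only [TensorProduct.comm_tmul, LinearMap.lTensor_tmul, toForm_mul_apply, ev₂_apply, triple,
      LinearMap.comp_apply, TensorProduct.map_tmul, LinearMap.mul'_apply,
      mul_comm]

theorem ev₂_comm_mul_right (t : H ⊗[k] H) (φ ψ χ : DualHopf k H) :
    ev₂ (TensorProduct.comm k H H t) (φ ⊗ₜ (ψ * χ)) =
      triple χ ψ φ (TensorProduct.assoc k H H H (LinearMap.rTensor H comul t)) := by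
  induction t using TensorProduct.induction_on with
  | zero => simp
  | add a b ha hb => simp only [map_add, LinearMap.add_apply, ha, hb]
  | tmul a b =>
    simp only [TensorProduct.comm_tmul, ev₂_tmul, LinearMap.rTensor_tmul, toForm_mul_apply]
    generalize comul (R := k) a = d
    induction d using TensorProduct.induction_on with
    | zero => simp
    | add a b ha hb =>
      simp only [map_add, LinearMap.add_apply, mul_add, TensorProduct.add_tmul, ha, hb]
    | tmul x y => simp; ring

variable [FiniteDimensional k H]

theorem conv_ev₂_comm_left (s t : H ⊗[k] H) (φ ψ χ : DualHopf k H) :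
    conv (TensorProduct.curry (ev₂ (TensorProduct.comm k H H s)) ψ)
      (TensorProduct.curry (ev₂ (TensorProduct.comm k H H t)) φ) χ =
      triple χ ψ φ (LinearMap.lTensor H (TensorProduct.mk k H H 1) t *
        LinearMap.lTensor H ((TensorProduct.mk k H H).flip 1) s) := by
  rw [conv_apply _ _ (ℛ k χ)]
  induction s using TensorProduct.induction_on with
  | zero => simp
  | add a b ha hb =>
    simp only [TensorProduct.curry_apply, map_add, LinearMap.add_apply, mul_add, add_mul] at ha hb ⊢
    simp only [← ha, ← hb, Finset.sum_add_distrib]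
  | tmul a b =>
    induction t using TensorProduct.induction_on with
    | zero => simp
    | add a b ha hb =>
      simp only [TensorProduct.curry_apply, map_add, LinearMap.add_apply, mul_add, add_mul]
        at ha hb ⊢
      simp only [← ha, ← hb, Finset.sum_add_distrib]
    | tmul c d =>
      simp only [TensorProduct.comm_tmul, TensorProduct.curry_apply, ev₂_tmul,
        LinearMap.lTensor_tmul, TensorProduct.mk_apply, LinearMap.flip_apply,
        Algebra.TensorProduct.tmul_mul_tmul, triple_tmul, one_mul, mul_one]
      rw [← ev_apply (c * a), ← conv_ev, conv_apply _ _ (ℛ k χ), Finset.sum_mul]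
      refine Finset.sum_congr rfl fun i _ => ?_
      simp only [ev_apply]
      ring

theorem conv_ev₂_comm_right (s t : H ⊗[k] H) (φ ψ χ : DualHopf k H) :
    conv ((TensorProduct.curry (ev₂ (TensorProduct.comm k H H s))).flip ψ)
      ((TensorProduct.curry (ev₂ (TensorProduct.comm k H H t))).flip χ) φ =
      triple χ ψ φ (TensorProduct.assoc k H H H
        (LinearMap.rTensor H ((TensorProduct.mk k H H).flip 1) t *
          LinearMap.rTensor H (TensorProduct.mk k H H 1) s)) := by
  rw [conv_apply _ _ (ℛ k φ)]
  induction s using TensorProduct.induction_on with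
  | zero => simp
  | add a b ha hb =>
    simp only [TensorProduct.curry_apply, LinearMap.flip_apply, map_add, LinearMap.add_apply,
        mul_add, add_mul] at ha hb ⊢
    simp only [← ha, ← hb, Finset.sum_add_distrib]
  | tmul a b =>
    induction t using TensorProduct.induction_on with
    | zero => simp
    | add a b ha hb =>
      simp only [TensorProduct.curry_apply, LinearMap.flip_apply, map_add, LinearMap.add_apply,
        mul_add, add_mul] at ha hb ⊢
      simp only [← ha, ← hb, Finset.sum_add_distrib]
    | tmul c d =>
      simp only [TensorProduct.comm_tmul, TensorProduct.curry_apply, ev₂_tmul,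
        LinearMap.rTensor_tmul, TensorProduct.mk_apply, LinearMap.flip_apply,
        Algebra.TensorProduct.tmul_mul_tmul, TensorProduct.assoc_tmul, triple_tmul, one_mul,
        mul_one]
      rw [← ev_apply (d * b), ← conv_ev, conv_apply _ _ (ℛ k φ), Finset.mul_sum, Finset.mul_sum]
      refine Finset.sum_congr rfl fun i _ => ?_
      simp only [ev_apply]
      ring

end DualHopf

/-! ### The dual coribbon structure and its copivotal form -/

namespace RibbonStructure

open DualHopf

variable {k H : Type*} [Field k] [Ring H] [HopfAlgebra k H] (X : RibbonStructure k H)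

theorem comm_comm (t : H ⊗[k] H) :
    TensorProduct.comm k H H (TensorProduct.comm k H H t) = t :=
  (TensorProduct.comm k H H).symm_apply_apply t

theorem comm_one : TensorProduct.comm k H H 1 = 1 := rfl

theorem counit_comp_mul' [FiniteDimensional k H] :
    counit ∘ₗ LinearMap.mul' k (DualHopf k H) = ev₂ 1 :=
  TensorProduct.ext' fun φ ψ => by
    simp [Bialgebra.counit_mul, Algebra.TensorProduct.one_def, counit_eq]

variable [FiniteDimensional k H]

/-- The coribbon structure on `H*` that is dual to a ribbon structure of `H`. -/
noncomputable def dual : CoribbonStructure k (DualHopf k H) where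
  r := ev₂ (TensorProduct.comm k H H (X.R : H ⊗[k] H))
  rbar := ev₂ (TensorProduct.comm k H H ((X.R⁻¹ : (H ⊗[k] H)ˣ) : H ⊗[k] H))
  nu := ev X.vInv
  nubar := ev X.v
  counit_conv_r := by rw [counit_comp_mul', conv_ev₂, mul_one]
  r_conv_counit := by
    rw [← LinearMap.comp_assoc, counit_comp_mul', ← ev₂_comm, comm_one, conv_ev₂, one_mul]
  rbar_conv_r := by
    rw [← LinearMap.comp_assoc, counit_comp_mul', ← ev₂_comm, comm_one, conv_ev₂, ← comm_mul,
      Units.mul_inv, comm_one]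
  r_conv_rbar := by
    rw [counit_comp_mul', conv_ev₂, ← comm_mul, Units.inv_mul, comm_one]
  mul_conv_r := hom_ext_ev fun x => by
    rw [ev_comp_conv_linearMap, ev_comp_linearMap_conv, ← LinearMap.comp_assoc, ev_comp_mul',
      ← ev₂_comm, comm_comm, conv_ev₂, conv_ev₂, ← comm_mul, X.R_mul_comul, comm_mul, comm_comm]
  r_mul_left φ ψ := LinearMap.ext fun χ => by
    rw [conv_ev₂_comm_left, ← X.comul_lTensor, ← ev₂_comm_mul_left]; rfl
  r_mul_right ψ χ := LinearMap.ext fun φ => by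
    rw [conv_ev₂_comm_right, ← X.comul_rTensor, ← ev₂_comm_mul_right]; rfl
  nu_conv_nubar := by rw [conv_ev, v_mul_vInv, counit_eq_ev]
  nubar_conv_nu := by rw [conv_ev, vInv_mul_v, counit_eq_ev]
  nu_central := hom_ext_ev fun x => by
    rw [ev_comp_conv_linearMap, ev_comp_linearMap_conv, LinearMap.comp_id, conv_ev, conv_ev,
      (X.vInv_commute x).eq]
  nu_mul := by
    rw [ev_comp_mul', map_ev_ev, ← ev₂_comm, comm_comm, conv_ev₂, conv_ev₂, comul_vInv, comm_mul,
      monodromy]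
    simp [← comm_eq, comm_mul]
  nu_antipode := by rw [ev_comp_antipode, antipode_vInv]

theorem dual_r_apply (φ ψ : DualHopf k H) : X.dual.r (φ ⊗ₜ[k] ψ) =
    LinearMap.mul' k k (TensorProduct.map ψ.toForm φ.toForm (X.R : H ⊗[k] H)) :=
  map_ev_comm_apply _ φ ψ

/-- For `R = ∑ a ⊗ b`, the value on `φ` is `∑ φ'(S(b)) φ''(a) = ∑ φ(a S(b))`, and `∑ a S(b) = S(u)`.
-/
theorem dual_drinfeld : X.dual.drinfeld = ev (antipode k X.u) := by
  rw [← mul_lTensor_antipode_R]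
  have h : ∀ t : H ⊗[k] H, ev₂ (TensorProduct.comm k H H t) ∘ₗ
      TensorProduct.map (antipode k) LinearMap.id ∘ₗ comul =
      ev (k := k) (LinearMap.mul' k H (LinearMap.lTensor H (antipode k) t)) := by
    intro t
    induction t using TensorProduct.induction_on with
    | zero => simp
    | add a b ha hb => simp only [map_add, LinearMap.add_comp, ha, hb]
    | tmul a b =>
      rw [LinearMap.lTensor_tmul, LinearMap.mul'_apply, ← conv_ev, conv, ← LinearMap.comp_assoc,
        ← LinearMap.comp_assoc]
      congr 1
      refine TensorProduct.ext' fun φ ψ => ?_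
      simp only [LinearMap.comp_apply, TensorProduct.map_tmul, LinearMap.id_apply,
        TensorProduct.comm_tmul, ev₂_tmul, LinearMap.mul'_apply]
      rfl
  exact h _

theorem dual_w : X.dual.w = ev ((X.GUnit⁻¹ : Hˣ) : H) := by
  rw [CoribbonStructure.w, dual_drinfeld, ← antipode_GUnit, coe_GUnit, G, antipode_mul_antidistrib,
    antipode_vInv]
  exact conv_ev _ _

theorem dual_wbar : X.dual.wbar = ev (X.GUnit : H) := by
  rw [CoribbonStructure.wbar, dual_w, ev_comp_antipode, antipode_GUnit_inv]

end RibbonStructure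

/-! ### Right-cointegrals as left-integrals of the dual -/

section Cointegral

variable {k H : Type*} [Field k] [Ring H] [HopfAlgebra k H]

theorem apply_lid_rTensor (lam ψ : H →ₗ[k] k) (x : H) :
    ψ (TensorProduct.lid k H (LinearMap.rTensor H lam (comul x))) = conv lam ψ x := by
  rw [conv_apply _ _ (ℛ k x)]
  nth_rw 1 [← (ℛ k x).eq]
  simp

/-- Linear forms separate points, so the identity in `H` may be tested on every `ψ`. Since the
product of `H*` is the opposite convolution product, this form of the condition is the one for a
left-integral. -/
theorem isRightCointegral_iff {lam : H →ₗ[k] k} :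
    IsRightCointegral lam ↔ ∀ ψ : H →ₗ[k] k, conv lam ψ = ψ 1 • lam := by
  refine ⟨fun h ψ => LinearMap.ext fun x => ?_, fun h x => ?_⟩
  · rw [← apply_lid_rTensor, h x]; simp [mul_comm]
  · rw [← sub_eq_zero, ← Module.forall_dual_apply_eq_zero_iff k]
    intro ψ
    rw [map_sub, apply_lid_rTensor, h ψ]; simp [mul_comm]

theorem isLeftIntegral_dual_iff [FiniteDimensional k H] {l : DualHopf k H} :
    IsLeftIntegral k l ↔ IsRightCointegral l.toForm := by
  rw [isRightCointegral_iff]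
  exact ⟨fun h ψ => congrArg DualHopf.toForm (h (DualHopf.toForm.symm ψ)),
    fun h φ => DualHopf.toForm.injective (h φ.toForm)⟩

/-! ### Existence of integrals -/

theorem conv_assoc (f g h : H →ₗ[k] k) : conv (conv f g) h = conv f (conv g h) :=
  congrArg WithConv.ofConv
    (mul_assoc (WithConv.toConv f) (WithConv.toConv g) (WithConv.toConv h))

/-- The convolution product of linear forms as a bilinear map. -/
noncomputable def convBilin : (H →ₗ[k] k) →ₗ[k] (H →ₗ[k] k) →ₗ[k] (H →ₗ[k] k) :=
  LinearMap.mk₂ k conv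
    (fun _ _ _ => by simp [conv, TensorProduct.map_add_left, LinearMap.comp_add, LinearMap.add_comp])
    (fun _ _ _ => by simp [conv, TensorProduct.map_smul_left, LinearMap.comp_smul,
      LinearMap.smul_comp])
    (fun _ _ _ => by simp [conv, TensorProduct.map_add_right, LinearMap.comp_add,
      LinearMap.add_comp])
    (fun _ _ _ => by simp [conv, TensorProduct.map_smul_right, LinearMap.comp_smul,
      LinearMap.smul_comp])

@[simp] theorem convBilin_apply (f g : H →ₗ[k] k) : convBilin f g = conv f g := rfl

theorem sum_conv_coord_smul {ι : Type*} [Fintype ι] (b : Module.Basis ι k H) (h : H) :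
    ∑ j, ∑ l, conv (b.coord j) (b.coord l) h • (b j ⊗ₜ[k] b l) = comul h := by
  simp_rw [conv_apply _ _ (ℛ k h), Finset.sum_smul]
  simp_rw [Finset.sum_comm (t := (ℛ k h).index)]
  conv_rhs => rw [← (ℛ k h).eq]
  refine Finset.sum_congr rfl fun i _ => ?_
  conv_rhs => rw [← b.sum_repr ((ℛ k h).left i), ← b.sum_repr ((ℛ k h).right i)]
  simp_rw [TensorProduct.sum_tmul, TensorProduct.tmul_sum, TensorProduct.smul_tmul_smul]
  rfl

/-- The comultiplication in terms of dual bases: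
`∑ e^i ⊗ e_i' ⊗ e_i'' = ∑ (e^j ⋆ e^l) ⊗ e_j ⊗ e_l`. -/
theorem sum_conv_coord {ι M : Type*} [Fintype ι] [AddCommGroup M] [Module k M]
    (b : Module.Basis ι k H) (T : (H →ₗ[k] k) →ₗ[k] H →ₗ[k] H →ₗ[k] M) :
    ∑ j, ∑ l, T (conv (b.coord j) (b.coord l)) (b j) (b l) =
      ∑ i, TensorProduct.lift (T (b.coord i)) (comul (b i)) := by
  have h1 : ∀ j l, T (conv (b.coord j) (b.coord l)) (b j) (b l) =
      ∑ i, TensorProduct.lift (T (b.coord i))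
        (conv (b.coord j) (b.coord l) (b i) • (b j ⊗ₜ[k] b l)) := fun j l => by
    conv_lhs => rw [← b.sum_dual_apply_smul_coord (conv (b.coord j) (b.coord l))]
    simp only [map_sum, LinearMap.sum_apply, map_smul, LinearMap.smul_apply,
      TensorProduct.lift.tmul]
  calc _ = ∑ j, ∑ i, ∑ l, TensorProduct.lift (T (b.coord i))
        (conv (b.coord j) (b.coord l) (b i) • (b j ⊗ₜ[k] b l)) :=
        Finset.sum_congr rfl fun j _ => by
          rw [Finset.sum_comm]; exact Finset.sum_congr rfl fun l _ => h1 j l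
    _ = _ := by
      rw [Finset.sum_comm]
      refine Finset.sum_congr rfl fun i _ => ?_
      rw [← sum_conv_coord_smul b (b i), map_sum]
      exact Finset.sum_congr rfl fun j _ => (map_sum _ _ _).symm

/-- The linear form `x ↦ ∑ (φ ⋆ e^i)(S²(e_i) x)` for dual bases `e^i`, `e_i`. -/
noncomputable def averaged {ι : Type*} [Fintype ι] (b : Module.Basis ι k H) (φ : H →ₗ[k] k) :
    H →ₗ[k] k :=
  ∑ i, conv φ (b.coord i) ∘ₗ LinearMap.mulLeft k (antipode k (antipode k (b i)))

theorem ev₂_injective [FiniteDimensional k H] :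
    Function.Injective (DualHopf.ev₂ : H ⊗[k] H →ₗ[k] _) := by
  let b := Module.finBasis k H
  have h : ∀ (t : H ⊗[k] H) (i j), (b.tensorProduct b).repr t (i, j) = DualHopf.ev₂ t
      (DualHopf.toForm.symm (b.coord i) ⊗ₜ DualHopf.toForm.symm (b.coord j)) := by
    intro t i j
    induction t using TensorProduct.induction_on with
    | zero => simp
    | tmul x y => simp [mul_comm]
    | add s t hs ht => simp only [map_add, Finsupp.add_apply, LinearMap.add_apply, hs, ht]
  intro s t hst
  refine (b.tensorProduct b).ext_elem fun ⟨i, j⟩ => ?_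
  rw [h, h, hst]

/-- Dual to the fact that the antipode of `H*` reverses products. -/
theorem comul_antipode [FiniteDimensional k H] (a : H) :
    comul (antipode k a) = TensorProduct.map (antipode k) (antipode k)
      (TensorProduct.comm k H H (comul (R := k) a)) := by
  have h : ∀ (t : H ⊗[k] H) (φ ψ : DualHopf k H), DualHopf.ev₂ (TensorProduct.map (antipode k)
      (antipode k) (TensorProduct.comm k H H t)) (ψ ⊗ₜ φ) =
      DualHopf.ev₂ t (antipode k φ ⊗ₜ antipode k ψ) := by
    intro t φ ψ
    induction t using TensorProduct.induction_on with
    | zero => simp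
    | tmul x y =>
      simp only [TensorProduct.comm_tmul, TensorProduct.map_tmul, DualHopf.ev₂_tmul]
      exact mul_comm _ _
    | add s t hs ht => simp only [map_add, LinearMap.add_apply, hs, ht]
  refine ev₂_injective (TensorProduct.ext' fun ψ φ => ?_)
  rw [DualHopf.ev₂_comul_antipode, h]

theorem comul_antipode_sq [FiniteDimensional k H] (a : H) :
    comul (antipode k (antipode k a)) = TensorProduct.map (antipode k ∘ₗ antipode k)
      (antipode k ∘ₗ antipode k) (comul (R := k) a) := by
  rw [comul_antipode, comul_antipode, ← (ℛ k a).eq]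
  simp

/-- Moves the factor `S²(a)` out of `χ` and in front of `x`: on the right the form `ψ` acquires the
factor `S(a''') S²(a'') = S(S(a'') a''')`, which collapses to a counit. -/
theorem conv_comp_mulLeft_antipode_sq [FiniteDimensional k H] (χ ψ : H →ₗ[k] k) (a x : H) :
    conv (χ ∘ₗ LinearMap.mulLeft k (antipode k (antipode k a))) ψ x =
      ∑ r ∈ (ℛ k a).index, conv χ (ψ ∘ₗ LinearMap.mulLeft k (antipode k ((ℛ k a).right r)))
        (antipode k (antipode k ((ℛ k a).left r)) * x) := by
  have h : ∀ r, conv χ (ψ ∘ₗ LinearMap.mulLeft k (antipode k ((ℛ k a).right r)))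
        (antipode k (antipode k ((ℛ k a).left r)) * x) =
      ∑ s ∈ (ℛ k ((ℛ k a).left r)).index, ∑ i ∈ (ℛ k x).index,
        χ (antipode k (antipode k ((ℛ k ((ℛ k a).left r)).left s)) * (ℛ k x).left i) *
          ψ (antipode k (antipode k ((ℛ k ((ℛ k a).left r)).right s) * (ℛ k a).right r) *
            (ℛ k x).right i) := by
    intro r
    rw [conv, LinearMap.comp_apply, LinearMap.comp_apply, Bialgebra.comul_mul, comul_antipode_sq]
    nth_rw 1 [← (ℛ k ((ℛ k a).left r)).eq, ← (ℛ k x).eq]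
    simp [Finset.sum_mul_sum, antipode_mul_antidistrib, mul_assoc]
  let F : H ⊗[k] (H ⊗[k] H) →ₗ[k] k := ∑ i ∈ (ℛ k x).index, LinearMap.mul' k k ∘ₗ
    TensorProduct.map (χ ∘ₗ LinearMap.mulRight k ((ℛ k x).left i) ∘ₗ antipode k ∘ₗ antipode k)
      (ψ ∘ₗ LinearMap.mulRight k ((ℛ k x).right i) ∘ₗ antipode k ∘ₗ LinearMap.mul' k H ∘ₗ
        LinearMap.rTensor H (antipode k))
  have hF : ∀ y c, F (y ⊗ₜ comul c) = ∑ i ∈ (ℛ k x).index,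
      χ (antipode k (antipode k (counit (R := k) c • y)) * (ℛ k x).left i) *
        ψ ((ℛ k x).right i) := fun y c => by
    simp only [F, LinearMap.sum_apply]
    refine Finset.sum_congr rfl fun i _ => ?_
    simp [mul_antipode_rTensor_comul_apply, Algebra.algebraMap_eq_smul_one]
    ring
  have h2 := congrArg F (sum_tmul_tmul_eq (ℛ k a) (fun r => ℛ k ((ℛ k a).left r))
    (fun r => ℛ k ((ℛ k a).right r)))
  simp_rw [h]
  refine Eq.trans ?_ (h2.symm.trans ?_)
  · simp_rw [← TensorProduct.tmul_sum, (ℛ k _).eq, map_sum, hF]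
    rw [Finset.sum_comm, conv_apply _ _ (ℛ k x)]
    refine Finset.sum_congr rfl fun i _ => ?_
    rw [← Finset.sum_mul, ← map_sum, ← Finset.sum_mul, ← map_sum, ← map_sum, sum_smul_counit]
    rfl
  · simp only [map_sum, F, LinearMap.sum_apply]
    simp

/-- Moving `S²(e_i)` outside produces `e_i' ⊗ e_i''`, which `sum_conv_coord` trades for `e^j ⋆ e^l`.
The sum over `l` then decouples as `∑ e^l ⋆ ψ(S(e_l) ·) = ψ(1) ε`, and the average reappears. -/
theorem conv_averaged [FiniteDimensional k H] {ι : Type*} [Fintype ι] (b : Module.Basis ι k H)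
    (φ ψ : H →ₗ[k] k) : conv (averaged b φ) ψ = ψ 1 • averaged b φ := by
  ext x
  let Ψ : H →ₗ[k] H →ₗ[k] k := (LinearMap.mul k H).compr₂ ψ ∘ₗ antipode k
  let T : (H →ₗ[k] k) →ₗ[k] H →ₗ[k] H →ₗ[k] k := LinearMap.mk₂ k
    (fun χ a => LinearMap.applyₗ (antipode k (antipode k a) * x) ∘ₗ convBilin (convBilin φ χ) ∘ₗ Ψ)
    (fun _ _ _ => by simp only [map_add, LinearMap.add_comp, LinearMap.comp_add])
    (fun _ _ _ => by simp only [map_smul, LinearMap.smul_comp, LinearMap.comp_smul])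
    (fun _ _ _ => by ext; simp [add_mul]) (fun _ _ _ => by ext; simp)
  have hT : ∀ χ a c, T χ a c = conv (conv φ χ) (ψ ∘ₗ LinearMap.mulLeft k (antipode k c))
    (antipode k (antipode k a) * x) := fun _ _ _ => rfl
  have hc : ∀ c, ψ ∘ₗ LinearMap.mulLeft k (antipode k c) = Ψ c := fun _ => rfl
  have h1 : ∀ i, conv (conv φ (b.coord i) ∘ₗ LinearMap.mulLeft k (antipode k (antipode k (b i))))
      ψ x = TensorProduct.lift (T (b.coord i)) (comul (b i)) := fun i => by
    rw [conv_comp_mulLeft_antipode_sq, ← (ℛ k (b i)).eq, map_sum]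
    rfl
  -- At `h` the left side is `ψ(S(h') h'')`, since `∑ e^l(h') e_l = h'`.
  have h2 : ∑ l, conv (b.coord l) (Ψ (b l)) = ψ 1 • counit := by
    ext h
    simp_rw [LinearMap.sum_apply, conv_apply _ _ (ℛ k h)]
    rw [Finset.sum_comm]
    have h3 : ∀ i, ∑ l, b.coord l ((ℛ k h).left i) * Ψ (b l) ((ℛ k h).right i) =
        ψ (antipode k ((ℛ k h).left i) * (ℛ k h).right i) := fun i => by
      change _ = Ψ ((ℛ k h).left i) ((ℛ k h).right i)
      conv_rhs => rw [← b.sum_repr ((ℛ k h).left i)]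
      simp only [map_sum, map_smul, LinearMap.sum_apply, LinearMap.smul_apply, smul_eq_mul]
      rfl
    rw [Finset.sum_congr rfl fun i _ => h3 i, ← map_sum, sum_antipode_mul_eq_smul]
    simp [mul_comm]
  calc conv (averaged b φ) ψ x = ∑ i, conv (conv φ (b.coord i) ∘ₗ
        LinearMap.mulLeft k (antipode k (antipode k (b i)))) ψ x := by
        rw [averaged, ← convBilin_apply, map_sum]; simp
    _ = ∑ j, ∑ l, T (conv (b.coord j) (b.coord l)) (b j) (b l) := by
        rw [sum_conv_coord]; exact Finset.sum_congr rfl fun i _ => h1 i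
    _ = ∑ j, conv (conv φ (b.coord j)) (∑ l, conv (b.coord l) (Ψ (b l)))
          (antipode k (antipode k (b j)) * x) := by
        refine Finset.sum_congr rfl fun j _ => ?_
        rw [← convBilin_apply, map_sum, LinearMap.sum_apply]
        refine Finset.sum_congr rfl fun l _ => ?_
        rw [hT, hc, convBilin_apply, ← conv_assoc, ← conv_assoc]
    _ = (ψ 1 • averaged b φ) x := by
        rw [h2, averaged, Finset.smul_sum, LinearMap.sum_apply]
        refine Finset.sum_congr rfl fun j _ => ?_
        rw [← convBilin_apply, map_smul, convBilin_apply, conv_counit]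
        simp

/-- `∑ E(φ ⋆ e^j)(S(e_j) x) = φ(x)`, where `E` is `averaged`. -/
theorem sum_averaged {ι : Type*} [Fintype ι] (b : Module.Basis ι k H)
    (φ : H →ₗ[k] k) (x : H) :
    ∑ j, averaged b (conv φ (b.coord j)) (antipode k (b j) * x) = φ x := by
  let T : (H →ₗ[k] k) →ₗ[k] H →ₗ[k] H →ₗ[k] k := LinearMap.mk₂ k
    (fun χ a => conv φ χ ∘ₗ LinearMap.mulRight k x ∘ₗ antipode k ∘ₗ LinearMap.mulLeft k a ∘ₗ
      antipode k)
    (fun χ χ' _ => by ext; simp [← convBilin_apply]) (fun _ _ _ => by ext; simp [← convBilin_apply])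
    (fun _ _ _ => by ext; simp [add_mul]) (fun _ _ _ => by ext; simp)
  have hT : ∀ χ a c, T χ a c = conv φ χ (antipode k (a * antipode k c) * x) :=
    fun _ _ _ => rfl
  have h1 : ∀ i, TensorProduct.lift (T (b.coord i)) (comul (b i)) =
      conv φ (b.coord i) (counit (R := k) (b i) • x) := fun i => by
    rw [← (ℛ k (b i)).eq, map_sum]
    simp only [TensorProduct.lift.tmul, hT]
    rw [← map_sum, ← Finset.sum_mul, ← map_sum, sum_mul_antipode_eq_smul]
    simp
  calc _ = ∑ j, ∑ l, T (conv (b.coord j) (b.coord l)) (b j) (b l) := by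
        refine Finset.sum_congr rfl fun j _ => ?_
        rw [averaged, LinearMap.sum_apply]
        refine Finset.sum_congr rfl fun l _ => ?_
        rw [hT, ← conv_assoc, antipode_mul_antidistrib, mul_assoc]; rfl
    _ = ∑ i, conv φ (b.coord i) (counit (R := k) (b i) • x) := by
        rw [sum_conv_coord]; exact Finset.sum_congr rfl fun i _ => h1 i
    _ = conv φ (∑ i, counit (R := k) (b i) • b.coord i) x := by
        rw [← convBilin_apply, map_sum, LinearMap.sum_apply]
        exact Finset.sum_congr rfl fun i _ => by simp
    _ = φ x := by rw [b.sum_dual_apply_smul_coord, conv_counit]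

/-- If all averages vanished, `sum_averaged` for `φ = ε` at `1` would read `0 = 1`. -/
theorem exists_isRightCointegral [FiniteDimensional k H] :
    ∃ lam : H →ₗ[k] k, lam ≠ 0 ∧ IsRightCointegral lam := by
  by_contra! h
  have h0 : ∀ φ, averaged (Module.finBasis k H) φ = 0 := fun φ => by
    by_contra hne
    exact h _ hne (isRightCointegral_iff.2 (conv_averaged _ φ))
  have h1 := sum_averaged (Module.finBasis k H) counit 1
  simp [h0] at h1

end Cointegral

/-! ### Nondegeneracy of cointegrals, and dual-basis formulas from an integral -/

section Frobenius

variable {k H : Type*} [Field k] [Ring H] [HopfAlgebra k H]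

theorem IsRightCointegral.lid_map {lam : H →ₗ[k] k} (h : IsRightCointegral lam) (f : H →ₗ[k] H)
    (x : H) : TensorProduct.lid k H (TensorProduct.map lam f (comul x)) = lam x • f 1 := by
  rw [← map_smul, ← h x]
  nth_rw 1 [← (ℛ k x).eq]
  nth_rw 1 [← (ℛ k x).eq]
  simp

/-- `∑ λ(x Λ') S(Λ'') = λ(Λ) x` for a left integral `Λ`. -/
theorem IsRightCointegral.sum_smul_antipode {lam : H →ₗ[k] k} (h : IsRightCointegral lam)
    {L : H} (hL : IsLeftIntegral k L) (x : H) :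
    ∑ j ∈ (ℛ k L).index, lam (x * (ℛ k L).left j) • antipode k ((ℛ k L).right j) = lam L • x := by
  let f : H →ₗ[k] H := ∑ j ∈ (ℛ k L).index,
    (lam ∘ₗ LinearMap.mulRight k ((ℛ k L).left j)).smulRight (antipode k ((ℛ k L).right j))
  have hf : ∀ y, f y = ∑ j ∈ (ℛ k L).index,
      lam (y * (ℛ k L).left j) • antipode k ((ℛ k L).right j) := fun y => by
    simp [f, LinearMap.sum_apply]
  -- The defining identity of `λ` at `yΛ`, followed by `S`, reads `∑ λ(y'Λ') S(Λ'') S(y'') = λ(yΛ)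
  -- 1`, and `yΛ = ε(y)Λ`. Convolution with the identity then removes the factor `S(y'')`.
  have hc : conv f (antipode k) = lam L • (Algebra.linearMap k H ∘ₗ counit) := by
    ext y
    have h1 := h.lid_map (antipode k) (y * L)
    rw [Bialgebra.comul_mul, ← (ℛ k y).eq, ← (ℛ k L).eq] at h1
    rw [conv_apply _ _ (ℛ k y)]
    simp only [hf, Finset.sum_mul]
    simp only [Finset.sum_mul_sum, Algebra.TensorProduct.tmul_mul_tmul, map_sum,
      TensorProduct.map_tmul, TensorProduct.lid_tmul, antipode_mul_antidistrib] at h1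
    simp only [smul_mul_assoc]
    rw [h1, hL y]
    simp [Algebra.algebraMap_eq_smul_one, smul_smul, mul_comm]
  rw [← hf, eq_of_conv_antipode hc]
  have : conv (lam L • (Algebra.linearMap k H ∘ₗ counit)) LinearMap.id =
      lam L • (LinearMap.id : H →ₗ[k] H) := by
    have := congrArg WithConv.ofConv (one_mul (WithConv.toConv (LinearMap.id : H →ₗ[k] H)))
    refine Eq.trans ?_ (congrArg (lam L • ·) this)
    simp only [conv, TensorProduct.map_smul_left, LinearMap.smul_comp, LinearMap.comp_smul]
    rfl
  rw [this]; rfl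

/-- `∑ λ(Λ' x) Λ'' = λ(Λ) S(x)` for a right integral `Λ`. -/
theorem IsRightCointegral.sum_smul_right {lam : H →ₗ[k] k} (h : IsRightCointegral lam)
    {L : H} (hL : IsRightIntegral k L) (x : H) :
    ∑ j ∈ (ℛ k L).index, lam ((ℛ k L).left j * x) • (ℛ k L).right j = lam L • antipode k x := by
  let f : H →ₗ[k] H := ∑ j ∈ (ℛ k L).index,
    (lam ∘ₗ LinearMap.mulLeft k ((ℛ k L).left j)).smulRight ((ℛ k L).right j)
  have hf : ∀ y, f y = ∑ j ∈ (ℛ k L).index,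
      lam ((ℛ k L).left j * y) • (ℛ k L).right j := fun y => by
    simp [f, LinearMap.sum_apply]
  have hc : conv f LinearMap.id = lam L • (Algebra.linearMap k H ∘ₗ counit) := by
    ext y
    have h1 := h (L * y)
    rw [Bialgebra.comul_mul, ← (ℛ k y).eq, ← (ℛ k L).eq] at h1
    rw [conv_apply _ _ (ℛ k y)]
    simp only [hf, Finset.sum_mul]
    simp only [Finset.sum_mul_sum, Algebra.TensorProduct.tmul_mul_tmul, map_sum,
      LinearMap.rTensor_tmul, TensorProduct.lid_tmul] at h1
    simp only [smul_mul_assoc, LinearMap.id_apply]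
    rw [Finset.sum_comm, h1, hL y]
    simp [Algebra.algebraMap_eq_smul_one, smul_smul, mul_comm]
  rw [← hf, eq_of_conv_id hc]
  have : conv (lam L • (Algebra.linearMap k H ∘ₗ counit)) (antipode k) =
      lam L • (antipode k : H →ₗ[k] H) := by
    have := congrArg WithConv.ofConv (one_mul (WithConv.toConv (antipode k : H →ₗ[k] H)))
    refine Eq.trans ?_ (congrArg (lam L • ·) this)
    simp only [conv, TensorProduct.map_smul_left, LinearMap.smul_comp, LinearMap.comp_smul]
    rfl
  rw [this]; rfl

/-- `∑ λ(x Λ'') Λ' = ∑ λ(Λ'') S(x) Λ'` for a left integral `Λ`. -/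
theorem IsLeftIntegral.sum_smul_left {L : H} (hL : IsLeftIntegral k L) (lam : H →ₗ[k] k) (x : H) :
    ∑ j ∈ (ℛ k L).index, lam (x * (ℛ k L).right j) • (ℛ k L).left j =
      antipode k x * ∑ j ∈ (ℛ k L).index, lam ((ℛ k L).right j) • (ℛ k L).left j := by
  let f : H →ₗ[k] H := ∑ j ∈ (ℛ k L).index,
    (lam ∘ₗ LinearMap.mulRight k ((ℛ k L).right j)).smulRight ((ℛ k L).left j)
  have hf : ∀ y, f y = ∑ j ∈ (ℛ k L).index,
      lam (y * (ℛ k L).right j) • (ℛ k L).left j := fun y => by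
    simp [f, LinearMap.sum_apply]
  have hg : TensorProduct.rid k H (LinearMap.lTensor H lam (comul L)) =
      ∑ j ∈ (ℛ k L).index, lam ((ℛ k L).right j) • (ℛ k L).left j := by
    nth_rw 1 [← (ℛ k L).eq]
    simp
  -- This is `Δ(yL) = ε(y) Δ(L)` after `id ⊗ λ`; the factor `y'` is removed by convolution with `S`
  -- on the left.
  have hc : conv LinearMap.id f = (counit (R := k) (A := H)).smulRight
      (∑ j ∈ (ℛ k L).index, lam ((ℛ k L).right j) • (ℛ k L).left j) := by
    ext y
    have h1 := congrArg (fun t => TensorProduct.rid k H (LinearMap.lTensor H lam t))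
      (Bialgebra.comul_mul (R := k) y L)
    rw [hL y, map_smul, map_smul, map_smul, hg, ← (ℛ k y).eq, ← (ℛ k L).eq] at h1
    rw [conv_apply _ _ (ℛ k y), LinearMap.smulRight_apply, h1, Finset.sum_mul_sum]
    simp [hf, Finset.mul_sum]
  rw [← hf, eq_of_id_conv hc, conv_apply _ _ (ℛ k x)]
  conv_rhs => rw [← sum_smul_counit (ℛ k x), map_sum, Finset.sum_mul]
  simp

/-- `λ(S(x)) = λ(g x)` for the distinguished element `g = ∑ λ(Λ'') Λ'`. -/
theorem IsRightCointegral.apply_antipode {lam : H →ₗ[k] k} {L : H} (h : IsRightCointegral lam)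
    (hL' : IsRightIntegral k L) (h1 : lam L = 1) (x : H) :
    lam (antipode k x) =
      lam ((∑ j ∈ (ℛ k L).index, lam ((ℛ k L).right j) • (ℛ k L).left j) * x) := by
  have h2 := congrArg lam (h.sum_smul_right hL' x)
  rw [h1, one_smul] at h2
  rw [← h2]
  simp [Finset.sum_mul, mul_comm]

variable [FiniteDimensional k H]

/-- The cointegral identity at `zy` first gives `∑ λ(z'y') z''y'' = 0`, hence `∑ λ(z'y) z'' = 0` for
all `y` by cancelling the identity map under convolution. So `∑ λ(z' ·) ⊗ z''` vanishes in `H* ⊗ H`.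
Splitting `z''` again and inserting `S(z'') w` gives `0 = ∑ λ(z' S(z'') w) z''' = λ(w) z`; choose
`w` with `λ(w) ≠ 0`. -/
theorem IsRightCointegral.eq_zero_of_forall_mul {lam : H →ₗ[k] k} (h : IsRightCointegral lam)
    (hlam : lam ≠ 0) {z : H} (hz : ∀ y, lam (z * y) = 0) : z = 0 := by
  have h1 : ∀ y, TensorProduct.lid k H
      (LinearMap.rTensor H (lam ∘ₗ LinearMap.mulRight k y) (comul z)) = 0 := by
    intro y
    let f : H →ₗ[k] H := ∑ j ∈ (ℛ k z).index,
      (lam ∘ₗ LinearMap.mulLeft k ((ℛ k z).left j)).smulRight ((ℛ k z).right j)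
    have hf : ∀ y, f y = ∑ j ∈ (ℛ k z).index,
        lam ((ℛ k z).left j * y) • (ℛ k z).right j := fun y => by
      simp [f, LinearMap.sum_apply]
    have hc : conv f LinearMap.id = 0 := by
      ext y
      have h1 := h (z * y)
      rw [Bialgebra.comul_mul, ← (ℛ k y).eq, ← (ℛ k z).eq, hz] at h1
      simp only [Finset.sum_mul_sum, Algebra.TensorProduct.tmul_mul_tmul, map_sum,
        LinearMap.rTensor_tmul, TensorProduct.lid_tmul, zero_smul] at h1
      rw [conv_apply _ _ (ℛ k y)]
      simp only [hf, Finset.sum_mul, smul_mul_assoc, LinearMap.id_apply, LinearMap.zero_apply]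
      rw [Finset.sum_comm, h1]
    have h2 := eq_of_conv_id hc
    have h3 : f y = 0 := by rw [h2]; simp [conv]
    rw [← h3, hf, ← (ℛ k z).eq]
    simp
  let Λ : H →ₗ[k] DualHopf k H :=
    DualHopf.toForm.symm.toLinearMap ∘ₗ (LinearMap.mul k H).compr₂ lam
  have hΛ : ∀ a y, DualHopf.toForm (Λ a) y = lam (a * y) := fun _ _ => rfl
  have h2 : LinearMap.rTensor H Λ (comul z) = 0 := by
    refine DualHopf.evalLeft_ext fun y => ?_
    rw [map_zero, ← h1 y, ← (ℛ k z).eq]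
    simp [hΛ]
  obtain ⟨w, hw⟩ : ∃ w, lam w ≠ 0 := by
    by_contra! h0
    exact hlam (LinearMap.ext h0)
  let E : DualHopf k H ⊗[k] H →ₗ[k] k := contractLeft k H ∘ₗ
    TensorProduct.map DualHopf.toForm.toLinearMap (LinearMap.mulRight k w ∘ₗ antipode k)
  let F : DualHopf k H ⊗[k] (H ⊗[k] H) →ₗ[k] H := (TensorProduct.lid k H).toLinearMap ∘ₗ
    LinearMap.rTensor H E ∘ₗ (TensorProduct.assoc k (DualHopf k H) H H).symm.toLinearMap
  have hF : ∀ a b c, F (Λ a ⊗ₜ (b ⊗ₜ c)) = lam (a * antipode k b * w) • c := fun a b c => by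
    simp [F, E, hΛ, mul_assoc]
  have h3 : F (LinearMap.lTensor _ comul (LinearMap.rTensor H Λ (comul z))) = 0 := by
    rw [h2, map_zero, map_zero]
  have h4 := congrArg (fun t => F (LinearMap.rTensor _ Λ t))
    (sum_tmul_tmul_eq (ℛ k z) (fun r => ℛ k ((ℛ k z).left r)) (fun r => ℛ k ((ℛ k z).right r)))
  simp only [← TensorProduct.tmul_sum, (ℛ k _).eq] at h4
  have h5 : F (LinearMap.lTensor _ comul (LinearMap.rTensor H Λ (comul z))) = lam w • z := by
    conv_lhs => rw [← (ℛ k z).eq]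
    simp only [map_sum, LinearMap.rTensor_tmul, LinearMap.lTensor_tmul] at h4 ⊢
    rw [← h4]
    simp only [hF]
    conv_rhs => rw [← sum_counit_smul (ℛ k z), Finset.smul_sum]
    refine Finset.sum_congr rfl fun i _ => ?_
    rw [← Finset.sum_smul, ← map_sum, ← Finset.sum_mul, sum_mul_antipode_eq_smul]
    simp [smul_smul, mul_comm]
  rw [h3] at h5
  exact (smul_eq_zero.1 h5.symm).resolve_left hw

theorem IsRightCointegral.mulLeft_bijective {lam : H →ₗ[k] k} (h : IsRightCointegral lam)
    (hlam : lam ≠ 0) : Function.Bijective ((LinearMap.mul k H).compr₂ lam) := by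
  have hi : Function.Injective ((LinearMap.mul k H).compr₂ lam) := by
    rw [injective_iff_map_eq_zero]
    exact fun z hz => h.eq_zero_of_forall_mul hlam fun y => LinearMap.congr_fun hz y
  exact ⟨hi, (LinearMap.injective_iff_surjective_of_finrank_eq_finrank
    (Subspace.dual_finrank_eq (K := k) (V := H)).symm).1 hi⟩

/-- By nondegeneracy `ε = λ(L ·)` for some `L`. Both `Lx` and `ε(x) L` then represent the form `y ↦
ε(x) ε(y)`, so they are equal. -/
theorem IsRightCointegral.exists_integral {lam : H →ₗ[k] k} (h : IsRightCointegral lam)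
    (hlam : lam ≠ 0) : ∃ L : H, IsRightIntegral k L ∧ lam L = 1 := by
  obtain ⟨L, hL⟩ := (h.mulLeft_bijective hlam).2 counit
  have hL' : ∀ y, lam (L * y) = counit (R := k) y := fun y => LinearMap.congr_fun hL y
  refine ⟨L, fun x => ?_, ?_⟩
  · rw [← sub_eq_zero]
    refine h.eq_zero_of_forall_mul hlam fun y => ?_
    simp [sub_mul, mul_assoc, hL', Bialgebra.counit_mul]
  · rw [← mul_one L, hL', Bialgebra.counit_one]

theorem IsRightCointegral.eq_of_forall_mul_left {lam : H →ₗ[k] k} (h : IsRightCointegral lam)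
    (hlam : lam ≠ 0) {z w : H} (hz : ∀ y, lam (y * z) = lam (y * w)) : z = w := by
  rw [← sub_eq_zero, ← Module.forall_dual_apply_eq_zero_iff k]
  intro ψ
  obtain ⟨y, rfl⟩ := (h.mulLeft_bijective hlam).2 ψ
  simp [mul_sub, hz]

variable {lam : H →ₗ[k] k} {L : H}

/-- `∑ λ(S(Λ'') x) Λ' = x` for an integral with `λ(Λ) = 1`. -/
theorem IsRightCointegral.sum_smul_left (h : IsRightCointegral lam) (hL : IsLeftIntegral k L)
    (h1 : lam L = 1) (x : H) :
    ∑ j ∈ (ℛ k L).index, lam (antipode k ((ℛ k L).right j) * x) • (ℛ k L).left j = x := by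
  refine h.eq_of_forall_mul_left (by rintro rfl; simp at h1) fun y => ?_
  have h2 := congrArg (fun z => lam (z * x)) (h.sum_smul_antipode hL y)
  simpa [Finset.mul_sum, Finset.sum_mul, h1, mul_comm] using h2

/-- Apply `μ` to the expansion `y = ∑ λ(S(Λ'') y) Λ'` and use `∑ μ(Λ') S(Λ'') = μ(Λ) 1`. -/
theorem IsRightCointegral.unique (h : IsRightCointegral lam) (hL : IsLeftIntegral k L)
    (h1 : lam L = 1) {mu : H →ₗ[k] k} (hmu : IsRightCointegral mu) : mu = mu L • lam := by
  ext y
  have h2 := congrArg (fun z => lam (z * y)) (hmu.sum_smul_antipode hL 1)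
  conv_lhs => rw [← h.sum_smul_left hL h1 y]
  simpa [Finset.sum_mul, mul_comm] using h2

/-- Expanding `x = ∑ λ(S(Λ'') x) Λ'` gives `λ(xy) = ∑ λ(S(Λ'') x) λ(Λ' y)`, and `∑ λ(Λ' y) Λ'' =
S(y)`. The two expansions need `Λ` as a left and as a right integral: unimodularity enters here. -/
theorem IsRightCointegral.apply_mul (h : IsRightCointegral lam) (hL : IsLeftIntegral k L)
    (hL' : IsRightIntegral k L) (h1 : lam L = 1) (x y : H) :
    lam (x * y) = lam (antipode k (antipode k y) * x) := by
  have h2 := congrArg (fun z => lam (antipode k z * x)) (h.sum_smul_right hL' y)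
  conv_lhs => rw [← h.sum_smul_left hL h1 x]
  simpa [Finset.sum_mul, h1, mul_comm] using h2

end Frobenius

/-! ### The distinguished element is the square of the pivotal element -/

namespace RibbonStructure

variable {k H : Type*} [Field k] [Ring H] [HopfAlgebra k H] (X : RibbonStructure k H)
  {lam : H →ₗ[k] k} {L : H}

/-- `S(u) g = u` for the distinguished element `g = ∑ λ(Λ'') Λ'`. -/
theorem antipode_u_mul (h : IsRightCointegral lam) (hL : IsLeftIntegral k L)
    (hL' : IsRightIntegral k L) (h1 : lam L = 1) :
    antipode k X.u * ∑ j ∈ (ℛ k L).index, lam ((ℛ k L).right j) • (ℛ k L).left j = X.u := by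
  -- `e1` and `e2` compute `id ⊗ λ` on the two sides of `R Δ(Λ) = Δᵒᵖ(Λ) R`, giving `∑ a S(b) g` and
  -- `∑ S(b) a`.
  have e1 : ∀ t : H ⊗[k] H, TensorProduct.rid k H (LinearMap.lTensor H lam (t * comul L)) =
      LinearMap.mul' k H (LinearMap.lTensor H (antipode k) t) *
        ∑ j ∈ (ℛ k L).index, lam ((ℛ k L).right j) • (ℛ k L).left j := by
    intro t
    induction t using TensorProduct.induction_on with
    | zero => simp
    | add a b ha hb => simp only [add_mul, map_add, ha, hb]
    | tmul a b =>
      rw [LinearMap.lTensor_tmul, LinearMap.mul'_apply, mul_assoc, ← hL.sum_smul_left]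
      nth_rw 1 [← (ℛ k L).eq]
      simp [Finset.mul_sum]
  have e2 : ∀ t : H ⊗[k] H, TensorProduct.rid k H
      (LinearMap.lTensor H lam (TensorProduct.comm k H H (comul L) * t)) = antipodeMulOp t := by
    intro t
    induction t using TensorProduct.induction_on with
    | zero => simp
    | add a b ha hb => simp only [mul_add, map_add, ha, hb]
    | tmul a b =>
      have := h.sum_smul_right hL' b
      rw [h1, one_smul] at this
      rw [antipodeMulOp_tmul, ← this]
      nth_rw 1 [← (ℛ k L).eq]
      simp [Finset.sum_mul]
  rw [← mul_lTensor_antipode_R, ← e1, X.R_mul_comul, e2, u_eq]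

variable [FiniteDimensional k H]

theorem apply_G_antipode (h : IsRightCointegral lam) (hL : IsLeftIntegral k L)
    (hL' : IsRightIntegral k L) (h1 : lam L = 1) (x : H) :
    lam ((X.GUnit : H) * antipode k x) = lam ((X.GUnit : H) * x) := by
  have hg : ∑ j ∈ (ℛ k L).index, lam ((ℛ k L).right j) • (ℛ k L).left j =
      (X.GUnit : H) * (X.GUnit : H) := by
    refine X.isUnit_antipode_u.mul_left_cancel ?_
    rw [X.antipode_u_mul h hL hL' h1, coe_GUnit, G]
    calc X.u = X.v * X.v * (X.vInv * (X.u * X.vInv)) := by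
          rw [mul_assoc X.v, ← mul_assoc X.v X.vInv, v_mul_vInv, one_mul, ← mul_assoc, X.v_central,
            mul_assoc, v_mul_vInv, mul_one]
      _ = antipode k X.u * (X.u * X.vInv * (X.u * X.vInv)) := by
        rw [← u_mul_antipode_u, X.antipode_u_commute.eq, mul_assoc X.u X.vInv, mul_assoc]
  -- At `xG⁻¹` the left side is `λ(G S(x))` and the right side is `λ(G² x G⁻¹) = λ(G⁻¹ G² x)` by the
  -- twisted symmetry.
  have h2 := h.apply_antipode hL' h1 (x * ((X.GUnit⁻¹ : Hˣ) : H))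
  rw [antipode_mul_antidistrib, antipode_GUnit_inv, hg, ← mul_assoc,
    h.apply_mul hL hL' h1 _ ((X.GUnit⁻¹ : Hˣ) : H), antipode_GUnit_inv, antipode_GUnit] at h2
  rw [h2]
  simp [← mul_assoc]

end RibbonStructure

/-! ### Following the components of a diagram -/

/-- The event `e` can be met on the way from a point with direction `d` to a point with
direction `d'` (`true` for downward). -/
def Event.Joins : Event → Bool → Bool → Prop
  | .plain, d, d' => d' = d
  | .crossing _ _ c, d, d' => d = c ∧ d' = c
  | .maxRight, d, d' => d = false ∧ d' = true
  | .maxLeft, d, d' => d = false ∧ d' = true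
  | .minRight, d, d' => d = true ∧ d' = false
  | .minLeft, d, d' => d = true ∧ d' = false

/-- The event takes place on the over- or undercrossing strand of the crossing in the slice `t`. -/
def Event.IsAt (t : ℕ) (isOver : Bool) : Event → Prop
  | .crossing t' isOver' _ => t' = t ∧ isOver' = isOver
  | _ => False

instance (t : ℕ) (o : Bool) : DecidablePred (Event.IsAt t o) := fun e =>
  match e with
  | .crossing t' o' _ => inferInstanceAs (Decidable (t' = t ∧ o' = o))
  | .plain => inferInstanceAs (Decidable False)
  | .maxRight => inferInstanceAs (Decidable False)
  | .maxLeft => inferInstanceAs (Decidable False)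
  | .minRight => inferInstanceAs (Decidable False)
  | .minLeft => inferInstanceAs (Decidable False)

namespace LinkDiagram

variable (D : LinkDiagram)

theorem step_joins (p : DPoint) : (D.step p).2.Joins p.down (D.next p).down := by
  unfold next
  obtain ⟨t, j, _ | _⟩ := p
  · cases t with
    | zero => simp [step, Event.Joins]
    | succ t =>
      unfold step
      repeat' split
      all_goals simp_all [Event.Joins]
  · unfold step
    repeat' split
    all_goals simp_all [Event.Joins]

theorem width_succ {t : ℕ} {s : Slice} (h : D.slices[t]? = some s) :
    D.width (t + 1) = s.below (D.width t) := by
  rw [width, List.take_add_one, h]; simp [width]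

theorem fits_width {t : ℕ} {s : Slice} (h : D.slices[t]? = some s) : s.Fits (D.width t) :=
  D.fits t s h

theorem mem_crossings {t : ℕ} : t ∈ D.crossings ↔
    ∃ i, D.slices[t]? = some (.pos i) ∨ D.slices[t]? = some (.neg i) := by
  rw [crossings, Finset.mem_filter, Finset.mem_range, sign]
  cases h : D.slices[t]? with
  | none => simp
  | some s =>
    have : t < D.slices.length := by
      by_contra hlt
      rw [List.getElem?_eq_none (by omega)] at h
      cases h
    cases s <;> simp [Slice.sign, this]

/-- The two points of a crossing strand: the upper end `(t, a)` and the lower end `(t + 1, b)`. -/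
theorem exists_strand {t : ℕ} (ht : t ∈ D.crossings) (o : Bool) : ∃ a b : ℕ,
    a < D.width t ∧ b < D.width (t + 1) ∧ D.next ⟨t + 1, b, false⟩ = ⟨t, a, false⟩ ∧
    (∀ p, (D.step p).2.IsAt t o ↔ p = ⟨t, a, true⟩ ∨ p = ⟨t + 1, b, false⟩) ∧
    ∀ q, D.next q = ⟨t, a, false⟩ → q = ⟨t + 1, b, false⟩ := by
  obtain ⟨i, hi⟩ := D.mem_crossings.1 ht
  have hw : i + 2 ≤ D.width t ∧ D.width (t + 1) = D.width t := by
    rcases hi with hi | hi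
    · exact ⟨D.fits_width hi, D.width_succ hi⟩
    · exact ⟨D.fits_width hi, D.width_succ hi⟩
  -- The default branches of `step` fix upward points. `h0` and `hs` keep them away from level `t`,
  -- where they would be a second predecessor of the upper end.
  have h0 : t ≠ 0 := by
    rintro rfl
    simp [width] at hw
  have hs : ∀ s, s + 1 = t → D.slices[s]? ≠ none := by
    rintro s rfl h
    rw [List.getElem?_eq_none_iff] at h
    rw [List.getElem?_eq_none (by omega)] at hi
    simp at hi
  rcases hi with hi | hi <;> cases o
  · refine ⟨i, i + 1, by omega, by omega, by simp [next, step, hi], ?_, ?_⟩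
    · rintro ⟨s, j, _ | _⟩
      · rcases s with _ | s
        · simp [step, Event.IsAt]
        · unfold step
          grind [Event.IsAt]
      · unfold step
        grind [Event.IsAt]
    · rintro ⟨s, j, _ | _⟩
      · rcases s with _ | s
        · simp [next, step]; grind
        · unfold next step
          grind
      · unfold next step
        grind
  · refine ⟨i + 1, i, by omega, by omega, by simp [next, step, hi], ?_, ?_⟩
    · rintro ⟨s, j, _ | _⟩
      · rcases s with _ | s
        · simp [step, Event.IsAt]
        · unfold step
          grind [Event.IsAt]
      · unfold step
        grind [Event.IsAt]
    · rintro ⟨s, j, _ | _⟩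
      · rcases s with _ | s
        · simp [next, step]; grind
        · unfold next step
          grind
      · unfold next step
        grind
  · refine ⟨i + 1, i, by omega, by omega, by simp [next, step, hi], ?_, ?_⟩
    · rintro ⟨s, j, _ | _⟩
      · rcases s with _ | s
        · simp [step, Event.IsAt]
        · unfold step
          grind [Event.IsAt]
      · unfold step
        grind [Event.IsAt]
    · rintro ⟨s, j, _ | _⟩
      · rcases s with _ | s
        · simp [next, step]; grind
        · unfold next step
          grind
      · unfold next step
        grind
  · refine ⟨i, i + 1, by omega, by omega, by simp [next, step, hi], ?_, ?_⟩
    · rintro ⟨s, j, _ | _⟩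
      · rcases s with _ | s
        · simp [step, Event.IsAt]
        · unfold step
          grind [Event.IsAt]
      · unfold step
        grind [Event.IsAt]
    · rintro ⟨s, j, _ | _⟩
      · rcases s with _ | s
        · simp [next, step]; grind
        · unfold next step
          grind
      · unfold next step
        grind

namespace Traversal

variable {D} (T : D.Traversal)

/-- The point number `n` on the component number `i`. -/
def point (i : Fin T.m) (n : ℕ) : DPoint := D.next^[n] (T.start i)

theorem next_point (i : Fin T.m) (n : ℕ) : D.next (T.point i n) = T.point i (n + 1) :=
  (Function.iterate_succ_apply' D.next n _).symm

theorem exists_next_point (p : (i : Fin T.m) × Fin (T.len i)) :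
    ∃ n : Fin (T.len p.1), T.point p.1 n = D.next (T.point p.1 p.2) := by
  obtain ⟨i, n⟩ := p
  by_cases h : (n : ℕ) + 1 < T.len i
  · exact ⟨⟨n + 1, h⟩, (T.next_point i n).symm⟩
  · refine ⟨⟨0, T.len_pos i⟩, ?_⟩
    have : (n : ℕ) + 1 = T.len i := by omega
    simp only [next_point, this]
    exact (T.periodic i).symm

theorem exists_point_next (p : (i : Fin T.m) × Fin (T.len i)) :
    ∃ n : Fin (T.len p.1), D.next (T.point p.1 n) = T.point p.1 p.2 := by
  obtain ⟨i, n, hn⟩ := p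
  rcases n with _ | n
  · refine ⟨⟨T.len i - 1, Nat.sub_one_lt_of_lt hn⟩, ?_⟩
    have : T.len i - 1 + 1 = T.len i := by omega
    simp only [next_point, this]
    exact T.periodic i
  · exact ⟨⟨n, Nat.lt_of_succ_lt hn⟩, T.next_point i n⟩

/-- The upper end of the strand is visited exactly once. Visited downward, it carries the event
itself; visited upward, the point just before it is the lower end, which carries the event. -/
theorem existsUnique_isAt {t : ℕ} (ht : t ∈ D.crossings) (o : Bool) :
    ∃! p : (i : Fin T.m) × Fin (T.len i), (D.step (T.point p.1 p.2)).2.IsAt t o := by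
  obtain ⟨a, b, ha, hb, hab, hiff, hprev⟩ := D.exists_strand ht o
  -- A downward passage and an upward passage of the same strand would both visit its upper end, in
  -- opposite directions.
  have hunique : ∀ p q : (i : Fin T.m) × Fin (T.len i),
      T.point p.1 p.2 = ⟨t, a, true⟩ → T.point q.1 q.2 ≠ ⟨t + 1, b, false⟩ := by
    intro p q hp hq
    obtain ⟨n, hn⟩ := T.exists_next_point q
    rw [hq, hab] at hn
    have h := (T.cover t a ha).unique (y₁ := p) (y₂ := ⟨q.1, n⟩)
      ⟨congrArg DPoint.level hp, congrArg DPoint.pos hp⟩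
      ⟨congrArg DPoint.level hn, congrArg DPoint.pos hn⟩
    rw [h] at hp
    rw [hn] at hp
    simp at hp
  refine existsUnique_of_exists_of_unique ?_ ?_
  · obtain ⟨p, ⟨hl, hj⟩, -⟩ := T.cover t a ha
    have hp : T.point p.1 p.2 = ⟨t, a, (T.point p.1 p.2).down⟩ := by
      rw [← hl, ← hj]; rfl
    cases hd : (T.point p.1 p.2).down
    · obtain ⟨n, hn⟩ := T.exists_point_next p
      rw [hp, hd] at hn
      exact ⟨⟨p.1, n⟩, (hiff _).2 (Or.inr (hprev _ hn))⟩
    · rw [hd] at hp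
      exact ⟨p, (hiff _).2 (Or.inl hp)⟩
  · intro p q hp hq
    rcases (hiff _).1 hp with hp | hp <;> rcases (hiff _).1 hq with hq | hq
    · exact (T.cover t a ha).unique ⟨congrArg DPoint.level hp, congrArg DPoint.pos hp⟩
        ⟨congrArg DPoint.level hq, congrArg DPoint.pos hq⟩
    · exact (hunique _ _ hp hq).elim
    · exact (hunique _ _ hq hp).elim
    · exact (T.cover (t + 1) b hb).unique ⟨congrArg DPoint.level hp, congrArg DPoint.pos hp⟩
        ⟨congrArg DPoint.level hq, congrArg DPoint.pos hq⟩

theorem countP_events (i : Fin T.m) (t : ℕ) (o : Bool) : (T.events i).countP (Event.IsAt t o) =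
    ((Finset.range (T.len i)).filter fun n => (D.step (T.point i n)).2.IsAt t o).card := by
  rw [events, List.countP_map, List.countP_eq_length_filter]
  rfl

theorem exists_countP_events {t : ℕ} (ht : t ∈ D.crossings) (o : Bool) :
    ∃ i, (T.events i).countP (Event.IsAt t o) = 1 ∧
      ∀ j ≠ i, (T.events j).countP (Event.IsAt t o) = 0 := by
  obtain ⟨⟨i, n⟩, hp, hu⟩ := T.existsUnique_isAt ht o
  refine ⟨i, ?_, fun j hj => ?_⟩
  · rw [countP_events, Finset.card_eq_one]
    refine ⟨n, Finset.ext fun m => ?_⟩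
    rw [Finset.mem_filter, Finset.mem_range, Finset.mem_singleton]
    constructor
    · rintro ⟨hm, h⟩
      have := hu ⟨i, ⟨m, hm⟩⟩ h
      simp only [Sigma.mk.injEq, heq_eq_eq, true_and] at this
      rw [← this]
    · rintro rfl
      exact ⟨n.2, hp⟩
  · rw [countP_events, Finset.card_eq_zero, Finset.filter_eq_empty_iff]
    intro m hm h
    have := hu ⟨j, ⟨m, Finset.mem_range.1 hm⟩⟩ h
    simp only [Sigma.mk.injEq] at this
    exact hj this.1

end Traversal

end LinkDiagram

/-! ### Independence of the chosen expansions of tensors -/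

section Multilinear

variable {k V : Type*} [Field k] [AddCommGroup V] [Module k V] {K : Type*} [Fintype K]
  [DecidableEq K]

theorem MultilinearMap.eq_sum_basis {ι : Type*} [Fintype ι] [DecidableEq ι]
    (b : Module.Basis ι k V) (M : MultilinearMap k (fun _ : K × Bool => V) k)
    (m : K × Bool → V) :
    M m = ∑ s : K → ι × ι,
      (∏ c, b.repr (m (c, true)) (s c).1 * b.repr (m (c, false)) (s c).2) *
        M fun q => if q.2 then b (s q.1).1 else b (s q.1).2 := by
  conv_lhs => rw [← funext fun q => b.sum_repr (m q)]
  rw [M.map_sum]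
  let e : (K × Bool → ι) ≃ (K → ι × ι) :=
    { toFun := fun r c => (r (c, true), r (c, false))
      invFun := fun s q => if q.2 then (s q.1).1 else (s q.1).2
      left_inv := fun r => by ext ⟨c, _ | _⟩ <;> rfl
      right_inv := fun s => rfl }
  refine Fintype.sum_equiv e _ _ fun r => ?_
  rw [M.map_smul_univ, Fintype.prod_prod_type, smul_eq_mul]
  congr 1
  · refine Finset.prod_congr rfl fun c _ => ?_
    rw [Fintype.prod_bool]
    rfl
  · congr 1
    ext ⟨c, _ | _⟩ <;> rfl

/-- A sum of values of a multilinear form depends only on the tensors that are formed from its pairs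
of arguments. -/
theorem MultilinearMap.sum_eq_sum_basis {ι ι' : Type*} [Fintype ι] [DecidableEq ι] [Fintype ι']
    [DecidableEq ι'] (b : Module.Basis ι k V) (M : MultilinearMap k (fun _ : K × Bool => V) k)
    (X : ι' → V) (coef : K → ι' × ι' → k) (τ : K → V ⊗[k] V)
    (hτ : ∀ c, ∑ p, coef c p • (X p.1 ⊗ₜ[k] X p.2) = τ c) :
    ∑ s : K → ι' × ι', (∏ c, coef c (s c)) *
        M (fun q => if q.2 then X (s q.1).1 else X (s q.1).2) =
      ∑ s : K → ι × ι, (∏ c, (b.tensorProduct b).repr (τ c) ((s c).1, (s c).2)) *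
        M fun q => if q.2 then b (s q.1).1 else b (s q.1).2 := by
  have h : ∀ s : K → ι × ι, ∏ c, (b.tensorProduct b).repr (τ c) ((s c).1, (s c).2) =
      ∑ r : K → ι' × ι', ∏ c, (coef c (r c) *
        (b.repr (X (r c).1) (s c).1 * b.repr (X (r c).2) (s c).2)) := fun s => by
    rw [← Fintype.prod_sum fun c p =>
      coef c p * (b.repr (X p.1) (s c).1 * b.repr (X p.2) (s c).2)]
    refine Finset.prod_congr rfl fun c _ => ?_
    rw [← hτ, _root_.map_sum, Finsupp.finsetSum_apply]
    refine Finset.sum_congr rfl fun p _ => ?_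
    rw [_root_.map_smul, Finsupp.smul_apply, Module.Basis.tensorProduct_repr_tmul_apply,
      smul_eq_mul, smul_eq_mul, mul_comm (b.repr (X p.2) _)]
  simp_rw [h, Finset.sum_mul]
  rw [Finset.sum_comm]
  refine Finset.sum_congr rfl fun r _ => ?_
  rw [M.eq_sum_basis b, Finset.mul_sum]
  refine Finset.sum_congr rfl fun s _ => ?_
  rw [← mul_assoc, ← Finset.prod_mul_distrib]
  rfl

end Multilinear

/-! ### Multilinearity of the Kauffman-Radford evaluation in the beads -/

namespace RibbonStructure

variable {k H : Type*} [Field k] [Ring H] [HopfAlgebra k H] (X : RibbonStructure k H)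

theorem foldl_slide_congr {f g : ℕ → Bool → H} (es : List Event)
    (h : ∀ t o, es.countP (Event.IsAt t o) ≠ 0 → f t o = g t o) (st : ℤ × H) :
    es.foldl (slide (k := k) f) st = es.foldl (slide (k := k) g) st := by
  induction es generalizing st with
  | nil => rfl
  | cons e es ih =>
    have he : slide (k := k) f st e = slide (k := k) g st e := by
      cases e with
      | crossing t o d =>
        have := h t o (by simp [Event.IsAt])
        simp [slide, this]
      | _ => rfl
    rw [List.foldl_cons, List.foldl_cons, he]
    refine ih (fun t o ht => h t o ?_) _
    rw [List.countP_cons]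
    omega

theorem foldl_slide_fst (f g : ℕ → Bool → H) (es : List Event) (n : ℤ) (y z : H) :
    (es.foldl (slide (k := k) f) (n, y)).1 = (es.foldl (slide (k := k) g) (n, z)).1 := by
  induction es generalizing n y z with
  | nil => rfl
  | cons e es ih => cases e <;> exact ih _ _ _

theorem foldl_slide_snd (f : ℕ → Bool → H) (es : List Event) (n : ℤ) (y : H) :
    (es.foldl (slide (k := k) f) (n, y)).2 = (es.foldl (slide (k := k) f) (n, 1)).2 * y := by
  induction es generalizing n y with
  | nil => simp
  | cons e es ih =>
    cases e with
    | crossing t o d =>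
      rw [List.foldl_cons, List.foldl_cons, slide, ih]
      conv_rhs => rw [slide, ih]
      simp [mul_assoc]
    | _ => exact ih _ _

theorem foldl_slide_linear {f f₁ f₂ : ℕ → Bool → H} {t : ℕ} {o : Bool} {a b : k}
    (h : f t o = a • f₁ t o + b • f₂ t o)
    (h' : ∀ t' o', ¬(t' = t ∧ o' = o) → f₁ t' o' = f t' o' ∧ f₂ t' o' = f t' o')
    (es : List Event) (hes : es.countP (Event.IsAt t o) = 1) (n : ℤ) (y : H) :
    (es.foldl (slide (k := k) f) (n, y)).2 =
      a • (es.foldl (slide (k := k) f₁) (n, y)).2 + b • (es.foldl (slide (k := k) f₂) (n, y)).2 := by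
  induction es generalizing n y with
  | nil => simp at hes
  | cons e es ih =>
    rw [List.countP_cons] at hes
    by_cases he : e.IsAt t o
    -- The bead occurs only here, so the three families of beads agree on the rest of the list.
    · have h0 : es.countP (Event.IsAt t o) = 0 := by simp [he] at hes; simpa using hes
      have hc : ∀ t' o', es.countP (Event.IsAt t' o') ≠ 0 →
          f₁ t' o' = f t' o' ∧ f₂ t' o' = f t' o' := by
        intro t' o' hne
        refine h' t' o' ?_
        rintro ⟨rfl, rfl⟩
        exact hne h0
      cases e with
      | crossing t' o' d =>
        obtain ⟨rfl, rfl⟩ := he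
        simp only [List.foldl_cons, slide]
        rw [foldl_slide_congr es (fun t o ht => (hc t o ht).1),
          foldl_slide_congr es (fun t o ht => (hc t o ht).2), foldl_slide_snd,
          foldl_slide_snd f es _ (_ * y), foldl_slide_snd f es _ (_ * y), h]
        simp [mul_add, add_mul]
      | _ => exact he.elim
    · have h1 : es.countP (Event.IsAt t o) = 1 := by simpa [he] using hes
      cases e with
      | crossing t' o' d =>
        have := h' t' o' he
        simp only [List.foldl_cons, slide]
        rw [this.1, this.2]
        exact ih h1 _ _
      | _ => exact ih h1 _ _

theorem componentTrace_congr (lam : H →ₗ[k] k) {f g : ℕ → Bool → H} (es : List Event)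
    (h : ∀ t o, es.countP (Event.IsAt t o) ≠ 0 → f t o = g t o) :
    X.componentTrace lam f es = X.componentTrace lam g es := by
  rw [componentTrace, componentTrace, foldl_slide_congr es h]

theorem componentTrace_linear (lam : H →ₗ[k] k) {f f₁ f₂ : ℕ → Bool → H} {t : ℕ} {o : Bool}
    {a b : k} (h : f t o = a • f₁ t o + b • f₂ t o)
    (h' : ∀ t' o', ¬(t' = t ∧ o' = o) → f₁ t' o' = f t' o' ∧ f₂ t' o' = f t' o')
    (es : List Event) (hes : es.countP (Event.IsAt t o) = 1) :
    X.componentTrace lam f es =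
      a * X.componentTrace lam f₁ es + b * X.componentTrace lam f₂ es := by
  simp only [componentTrace]
  rw [foldl_slide_linear h h' es hes, foldl_slide_fst f₁ f es 0 1 1, foldl_slide_fst f₂ f es 0 1 1]
  simp [mul_add]

variable {D : LinkDiagram}

/-- The beads on the strands of the crossings, given by a family of elements of `H`. -/
noncomputable def beads (m : D.crossings × Bool → H) (t : ℕ) (o : Bool) : H :=
  if h : t ∈ D.crossings then m (⟨t, h⟩, o) else 0

/-- The slot `q` is met once, on a single component. That factor is linear in the bead, and the
other factors do not see it. -/
theorem prod_componentTrace_linear (lam : H →ₗ[k] k) (T : D.Traversal)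
    (m : D.crossings × Bool → H) (q : D.crossings × Bool) (a b : k) (x y : H) :
    ∏ i, X.componentTrace lam (beads (Function.update m q (a • x + b • y))) (T.events i) =
      a * ∏ i, X.componentTrace lam (beads (Function.update m q x)) (T.events i) +
      b * ∏ i, X.componentTrace lam (beads (Function.update m q y)) (T.events i) := by
  obtain ⟨⟨t, ht⟩, o⟩ := q
  obtain ⟨i, hi, hj⟩ := T.exists_countP_events ht o
  have hat : ∀ z, beads (Function.update m (⟨t, ht⟩, o) z) t o = z := fun z => by
    simp [beads, ht]
  have hoff : ∀ z w t' o', ¬(t' = t ∧ o' = o) →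
      beads (Function.update m (⟨t, ht⟩, o) z) t' o' =
        beads (Function.update m (⟨t, ht⟩, o) w) t' o' := fun z w t' o' hne => by
    unfold beads
    split_ifs with h
    · rw [Function.update_of_ne, Function.update_of_ne] <;> simpa using hne
    · rfl
  have hrest : ∀ z w, ∏ j ∈ Finset.univ.erase i,
      X.componentTrace lam (beads (Function.update m (⟨t, ht⟩, o) z)) (T.events j) =
      ∏ j ∈ Finset.univ.erase i,
      X.componentTrace lam (beads (Function.update m (⟨t, ht⟩, o) w)) (T.events j) := fun z w =>
    Finset.prod_congr rfl fun j hji => X.componentTrace_congr lam _ fun t' o' hne =>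
      hoff _ _ _ _ (by rintro ⟨rfl, rfl⟩; exact hne (hj j (Finset.ne_of_mem_erase hji)))
  rw [← Finset.mul_prod_erase _ _ (Finset.mem_univ i), ← Finset.mul_prod_erase _ _
    (Finset.mem_univ i), ← Finset.mul_prod_erase _ _ (Finset.mem_univ i),
    hrest (a • x + b • y) x, hrest y x, X.componentTrace_linear lam (a := a) (b := b)
      (f₁ := beads (Function.update m (⟨t, ht⟩, o) x))
      (f₂ := beads (Function.update m (⟨t, ht⟩, o) y)) (by simp only [hat])
      (fun t' o' h => ⟨hoff _ _ _ _ h, hoff _ _ _ _ h⟩) _ hi]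
  ring

/-- The product of the contributions of the components, as a multilinear form in the beads. -/
noncomputable def traceForm (lam : H →ₗ[k] k) (T : D.Traversal) :
    MultilinearMap k (fun _ : D.crossings × Bool => H) k :=
  MultilinearMap.mk' (fun m => ∏ i, X.componentTrace lam (beads m) (T.events i))
    (fun m q x y => by simpa using X.prod_componentTrace_linear lam T m q 1 1 x y)
    (fun m q c x => by simpa using X.prod_componentTrace_linear lam T m q c 0 x 0)

theorem beads_eq_pick {ι : Type*} (s : D.crossings → ι × ι) (Y : ι → H) :
    beads (fun q : D.crossings × Bool => if q.2 then Y (s q.1).1 else Y (s q.1).2) =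
      LinkDiagram.pick s Y 0 := by
  ext t o
  unfold beads LinkDiagram.pick
  split_ifs with h ho <;> simp_all

theorem traceForm_apply {ι : Type*} (lam : H →ₗ[k] k) (T : D.Traversal)
    (s : D.crossings → ι × ι) (Y : ι → H) :
    X.traceForm lam T (fun q => if q.2 then Y (s q.1).1 else Y (s q.1).2) =
      ∏ i, X.componentTrace lam (LinkDiagram.pick s Y 0) (T.events i) := by
  rw [← beads_eq_pick]; rfl

/-- The evaluation `TR` can be computed with any expansions of `R` and `R⁻¹`. -/
theorem krTR_eq [FiniteDimensional k H] (lam : H →ₗ[k] k) (T : D.Traversal) {ι : Type*} [Fintype ι]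
    [DecidableEq ι] (Y : ι → H) (coef : D.crossings → ι × ι → k)
    (h : ∀ c, ∑ p, coef c p • (Y p.1 ⊗ₜ[k] Y p.2) =
      if D.sign c = -1 then (X.R : H ⊗[k] H) else ((X.R⁻¹ : (H ⊗[k] H)ˣ) : H ⊗[k] H)) :
    X.krTR lam T = ∑ s : D.crossings → ι × ι, (∏ c, coef c (s c)) *
      ∏ i, X.componentTrace lam (LinkDiagram.pick s Y 0) (T.events i) := by
  have := (X.traceForm lam T).sum_eq_sum_basis (Module.finBasis k H) Y coef _ h
  simp only [traceForm_apply] at this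
  exact this.symm

end RibbonStructure

/-! ### Powers of the antipode and words along a component -/

theorem intPow_unit {M : Type*} [MonoidWithZero M] (x : Mˣ) (n : ℤ) :
    intPow (x : M) n = ((x ^ n : Mˣ) : M) := by
  cases n with
  | ofNat n => simp [intPow]
  | negSucc n => simp [intPow, zpow_negSucc]

namespace RibbonStructure

open DualHopf

variable {k H : Type*} [Field k] [Ring H] [HopfAlgebra k H] [FiniteDimensional k H]
  (X : RibbonStructure k H)

theorem antipode_GUnit_zpow (j : ℤ) :
    antipode k ((X.GUnit ^ j : Hˣ) : H) = ((X.GUnit ^ (-j) : Hˣ) : H) := by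
  induction j using Int.induction_on with
  | zero => simp
  | succ j ih =>
    rw [zpow_add_one, Units.val_mul, antipode_mul_antidistrib, ih, antipode_GUnit, neg_add_rev,
      zpow_add, Units.val_mul, zpow_neg_one]
  | pred j ih =>
    rw [zpow_sub_one, Units.val_mul, antipode_mul_antidistrib, ih, antipode_GUnit_inv, neg_sub,
      sub_eq_add_neg, zpow_one_add, Units.val_mul]

/-- The antipode as a unit of the ring of endomorphisms. -/
noncomputable def antipodeUnit : (Module.End k H)ˣ := X.isUnit_antipode.unit

theorem coe_antipodeUnit : (X.antipodeUnit : Module.End k H) = antipode k := rfl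

theorem antipodeUnit_zpow_two_mul (j : ℤ) (x : H) :
    ((X.antipodeUnit ^ (2 * j) : (Module.End k H)ˣ) : Module.End k H) x =
      ((X.GUnit ^ j : Hˣ) : H) * x * ((X.GUnit ^ (-j) : Hˣ) : H) := by
  have h2 : ∀ x, ((X.antipodeUnit ^ (2 : ℤ) : (Module.End k H)ˣ) : Module.End k H) x =
      (X.GUnit : H) * x * ((X.GUnit⁻¹ : Hˣ) : H) := fun x => by
    rw [← X.antipode_sq]; rfl
  induction j using Int.induction_on generalizing x with
  | zero => simp
  | succ j ih =>
    rw [mul_add, mul_one, zpow_add, Units.val_mul, Module.End.mul_apply, h2, ih, zpow_add_one,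
      neg_add_rev, zpow_add]
    simp [mul_assoc]
  | pred j ih =>
    have h3 := ih (((X.GUnit⁻¹ : Hˣ) : H) * x * (X.GUnit : H))
    -- For the downward induction, write `x` as `S²` of its conjugate `G⁻¹ x G`.
    have h4 : ((X.antipodeUnit ^ (2 : ℤ) : (Module.End k H)ˣ) : Module.End k H)
        (((X.GUnit⁻¹ : Hˣ) : H) * x * (X.GUnit : H)) = x := by
      rw [h2]; simp [mul_assoc]
    rw [← h4, ← Module.End.mul_apply, ← Units.val_mul, ← zpow_add]
    have e : 2 * (-(j : ℤ) - 1) + 2 = 2 * -j := by ring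
    rw [e, h3, h4, zpow_sub_one, neg_sub, sub_neg_eq_add, zpow_one_add]
    simp [mul_assoc]

theorem slide_crossing (f : ℕ → Bool → H) (st : ℤ × H) (t : ℕ) (o d : Bool) :
    slide (k := k) f st (.crossing t o d) = (st.1,
      ((X.antipodeUnit ^ (-st.1) : (Module.End k H)ˣ) : Module.End k H) (f t o) * st.2) := by
  rw [slide, ← coe_antipodeUnit X, intPow_unit]

/-- The element of `H` that is contributed by an event, for beads `f t isOver` on the strands of the
crossings. -/
noncomputable def eventElement (f : ℕ → Bool → H) : Event → H
  | .crossing t o true => f t o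
  | .crossing t o false => antipode k (f t o)
  | .minRight => ((X.GUnit⁻¹ : Hˣ) : H)
  | .maxRight => (X.GUnit : H)
  | _ => 1

theorem dual_eventForm (f : ℕ → Bool → H) (e : Event) :
    X.dual.eventForm (fun t o => ev (f t o)) e = ev (X.eventElement f e) := by
  cases e with
  | crossing t o d => cases d <;> rfl
  | minRight => exact X.dual_w
  | maxRight => exact X.dual_wbar
  | _ => rfl

/-- The product of the elements of a list of events, in the order of travel. -/
noncomputable def word (f : ℕ → Bool → H) (es : List Event) : H :=
  es.foldl (fun y e => y * X.eventElement f e) 1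

theorem dual_wordForm (f : ℕ → Bool → H) (es : List Event) :
    X.dual.wordForm (fun t o => ev (f t o)) es = ev (X.word f es) := by
  have h : ∀ y : H, es.foldl (fun F e => conv (X.dual.eventForm (fun t o => ev (f t o)) e) F)
      (ev y) = ev (es.foldl (fun y e => y * X.eventElement f e) y) := by
    induction es with
    | nil => intro y; rfl
    | cons e es ih => intro y; rw [List.foldl_cons, dual_eventForm, conv_ev, ih]; rfl
  exact h 1

theorem toForm_dualTrace (l : DualHopf k H) (y : H) :
    toForm (X.dual.dualTrace l) y = toForm l (y * X.GUnit) := by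
  have h : ∀ t : DualHopf k H ⊗[k] DualHopf k H, TensorProduct.lid k _
      (TensorProduct.map X.dual.wbar LinearMap.id t) = evalLeft (X.GUnit : H) t := by
    intro t
    rw [dual_wbar]; rfl
  rw [CoribbonStructure.dualTrace, h, comul_eq, evalLeft_comulDual, toForm_shift]

/-- After `n` steps from a base point, the strand points upward iff the number of half turns is
even, and the word in `H` is the image under the antipode of the product of the beads, up to a power
of the pivotal element. -/
theorem word_eq {D : LinkDiagram} (p : DPoint) (hp : p.down = false) (f : ℕ → Bool → H) (n : ℕ) :
    ((D.next^[n] p).down = false ↔ Even (((List.range n).map fun n =>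
        (D.step (D.next^[n] p)).2).foldl (slide (k := k) f) (0, 1)).1) ∧
      X.word f ((List.range n).map fun n => (D.step (D.next^[n] p)).2) =
        antipode k (((List.range n).map fun n =>
          (D.step (D.next^[n] p)).2).foldl (slide (k := k) f) (0, 1)).2 *
        ((X.GUnit ^ (-((((List.range n).map fun n =>
          (D.step (D.next^[n] p)).2).foldl (slide (k := k) f) (0, 1)).1 / 2)) : Hˣ) : H) := by
  induction n with
  | zero => simp [hp, word]
  | succ n ih =>
    rw [List.range_succ, List.map_append, List.foldl_append, word, List.foldl_append,
      Function.iterate_succ_apply']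
    change ((D.next^[n] p).down = false ↔ _) ∧ X.word f _ = _ at ih
    rw [word] at ih
    generalize ((List.range n).map fun n =>
        (D.step (D.next^[n] p)).2).foldl (slide (k := k) f) (0, 1) = st at ih ⊢
    rw [ih.2]
    obtain ⟨hst, -⟩ := ih
    have hj := D.step_joins (D.next^[n] p)
    simp only [List.map_cons, List.map_nil, List.foldl_cons, List.foldl_nil]
    generalize (D.next (D.next^[n] p)).down = d' at *
    generalize (D.next^[n] p).down = d at *
    generalize (D.step (D.next^[n] p)).2 = e at *
    obtain ⟨m, y⟩ := st
    simp only at hst ⊢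
    cases e with
    | plain =>
      obtain rfl : d' = d := hj
      exact ⟨hst, mul_one _⟩
    | crossing t o c =>
      obtain ⟨rfl, rfl⟩ : d = c ∧ d' = c := hj
      rw [slide_crossing X]
      refine ⟨hst, ?_⟩
      rw [antipode_mul_antidistrib, mul_assoc, mul_assoc]
      congr 1
      -- Upward after `2j` half turns, the word gains `S(b)` and the slid bead is `S^(-2j)(b) =
      -- G^(-j) b G^j`. Downward after `2j + 1`, it gains `b`, and `S` of the slid bead is again
      -- `S^(-2j)(b)`. In both cases the conjugation moves the new factor past `G^(-j)`.
      cases d' with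
      | false =>
        obtain ⟨j, rfl⟩ := hst.1 rfl
        have e1 : (j + j) / 2 = j := by omega
        have e2 : -(j + j) = 2 * -j := by ring
        simp only [e1, e2, antipodeUnit_zpow_two_mul, antipode_mul_antidistrib,
          antipode_GUnit_zpow, eventElement, neg_neg, mul_assoc]
        rw [← Units.val_mul, ← zpow_add, add_neg_cancel, zpow_zero, Units.val_one, mul_one]
      | true =>
        obtain ⟨j, rfl⟩ := Int.not_even_iff_odd.1 fun h => Bool.noConfusion (hst.2 h)
        have e1 : (2 * j + 1) / 2 = j := by omega
        have e2 : 1 + -(2 * j + 1) = 2 * -j := by ring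
        rw [e1, ← coe_antipodeUnit X, ← Module.End.mul_apply, ← Units.val_mul, ← zpow_one_add, e2,
          antipodeUnit_zpow_two_mul, neg_neg, mul_assoc, ← Units.val_mul, ← zpow_add,
          add_neg_cancel, zpow_zero, Units.val_one, mul_one]
        rfl
    | maxRight =>
      obtain ⟨rfl, rfl⟩ : d = false ∧ d' = true := hj
      obtain ⟨j, rfl⟩ := hst.1 rfl
      have e0 : ¬Even (j + j - 1) := Int.not_even_iff_odd.2 ⟨j - 1, by ring⟩
      refine ⟨by simp [slide, e0], ?_⟩
      have e1 : (j + j) / 2 = j := by omega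
      -- Division rounds down, so exactly the extrema passed to the right change the exponent, in
      -- step with the factors `G` and `G⁻¹` of the word.
      have e2 : (j + j - 1) / 2 = j - 1 := by omega
      simp only [slide, eventElement, e1, e2]
      rw [mul_assoc, neg_sub, sub_eq_neg_add, zpow_add_one, Units.val_mul]
    | maxLeft =>
      obtain ⟨rfl, rfl⟩ : d = false ∧ d' = true := hj
      obtain ⟨j, rfl⟩ := hst.1 rfl
      have e0 : ¬Even (j + j + 1) := Int.not_even_iff_odd.2 ⟨j, by ring⟩
      refine ⟨by simp [slide, e0], ?_⟩
      have e1 : (j + j) / 2 = j := by omega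
      have e2 : (j + j + 1) / 2 = j := by omega
      simp only [slide, eventElement, e1, e2, mul_one]
    | minRight =>
      obtain ⟨rfl, rfl⟩ : d = true ∧ d' = false := hj
      obtain ⟨j, rfl⟩ := Int.not_even_iff_odd.1 fun h => Bool.noConfusion (hst.2 h)
      refine ⟨by simp [slide, parity_simps], ?_⟩
      have e1 : (2 * j + 1) / 2 = j := by omega
      have e2 : (2 * j + 1 + 1) / 2 = j + 1 := by omega
      simp only [slide, eventElement, e1, e2]
      rw [mul_assoc, neg_add, ← sub_eq_add_neg, zpow_sub_one, Units.val_mul]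
    | minLeft =>
      obtain ⟨rfl, rfl⟩ : d = true ∧ d' = false := hj
      obtain ⟨j, rfl⟩ := Int.not_even_iff_odd.1 fun h => Bool.noConfusion (hst.2 h)
      refine ⟨by simp [slide, parity_simps], ?_⟩
      have e1 : (2 * j + 1) / 2 = j := by omega
      have e2 : (2 * j + 1 - 1) / 2 = j := by omega
      simp only [slide, eventElement, e1, e2, mul_one]

end RibbonStructure

/-! ### The left-integral as a dual quantum trace -/

section

open DualHopf

variable {k H : Type*} [Field k] [Ring H] [HopfAlgebra k H]

theorem IsRightCointegral.isDualQuantumTrace [FiniteDimensional k H] {l : DualHopf k H} {L : H}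
    (h : IsRightCointegral l.toForm) (hL : IsLeftIntegral k L)
    (hL' : IsRightIntegral k L) (h1 : l.toForm L = 1) : IsDualQuantumTrace k l := by
  have e : ∀ (x y : H) (t : DualHopf k H ⊗[k] DualHopf k H),
      toForm (evalLeft y (TensorProduct.comm k _ _ t)) x = toForm (evalLeft x t) y := by
    intro x y t
    induction t using TensorProduct.induction_on with
    | zero => simp
    | add s t hs ht => simp only [map_add, LinearMap.add_apply, hs, ht]
    | tmul φ ψ => simp [mul_comm]
  refine evalLeft_ext fun y => ext_toForm fun x => ?_
  rw [e, ← LinearMap.lTensor, evalLeft_lTensor, comul_eq, evalLeft_comulDual, evalLeft_comulDual,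
    toForm_shift, h.apply_mul hL hL' h1]
  rfl

theorem LinkDiagram.pick_ev {D : LinkDiagram} {ι : Type*} (s : D.crossings → ι × ι) (Y : ι → H) :
    LinkDiagram.pick s (fun p => ev (k := k) (Y p)) 0 =
      fun t o => ev (k := k) (LinkDiagram.pick s Y 0 t o) := by
  ext t o
  unfold LinkDiagram.pick
  split_ifs with h <;> simp

end

/-! ### Comparison of the two evaluations -/

namespace RibbonStructure

open DualHopf

variable {k H : Type*} [Field k] [Ring H] [HopfAlgebra k H] [FiniteDimensional k H]
  (X : RibbonStructure k H)

section Evaluation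

variable {l : DualHopf k H} {L : H}

/-- For word `S(y) G^(-d) = S(G^d y)`, the twisted symmetry moves the `G` of the dual trace to the
left, and `λ(G S(x)) = λ(G x)` then removes the antipode. -/
theorem wordForm_dualTrace (h : IsRightCointegral l.toForm) (hL : IsLeftIntegral k L)
    (hL' : IsRightIntegral k L) (h1 : l.toForm L = 1) {D : LinkDiagram} (T : D.Traversal)
    (i : Fin T.m) (f : ℕ → Bool → H) :
    X.dual.wordForm (fun t o => ev (f t o)) (T.events i) (X.dual.dualTrace l) =
      X.componentTrace l.toForm f (T.events i) := by
  have hw := (X.word_eq (D := D) (T.start i) (T.start_up i) f (T.len i)).2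
  change X.word f (T.events i) = antipode k ((T.events i).foldl (slide (k := k) f) (0, 1)).2 * _
    at hw
  have hG : antipode k (antipode k (X.GUnit : H)) = (X.GUnit : H) := by
    rw [antipode_sq, Units.mul_inv_cancel_right]
  rw [dual_wordForm, ev_apply, toForm_dualTrace, h.apply_mul hL hL' h1, hG, hw,
    ← antipode_GUnit_zpow, ← antipode_mul_antidistrib, X.apply_G_antipode h hL hL' h1,
    ← intPow_unit]
  rfl

theorem hkrEvaluation_dual (h : IsRightCointegral l.toForm) (hL : IsLeftIntegral k L)
    (hL' : IsRightIntegral k L) (h1 : l.toForm L = 1) {D : LinkDiagram} (T : D.Traversal) :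
    X.dual.hkrEvaluation l T = X.krTR l.toForm T := by
  let b := Module.finBasis k (DualHopf k H)
  -- `Y` is the basis of `H` dual to the chosen basis `b` of `H*`. Expanding `R` and `R⁻¹` in it has
  -- the values of `r` and `r̄` on `b` as coefficients; the flip in `r` accounts for the order `b
  -- p.2 ⊗ b p.1`.
  choose Y hY using fun p => (ev_bijective (k := k) (H := H)).2 (b.coord p)
  have hsum : ∀ x : H, ∑ p, toForm (b p) x • Y p = x := fun x => by
    apply (ev_bijective (k := k) (H := H)).1
    rw [map_sum]
    simp_rw [map_smul, hY]
    exact b.sum_dual_apply_smul_coord (ev x)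
  have htensor : ∀ t : H ⊗[k] H, ∑ p : Fin _ × Fin _,
      ev₂ (TensorProduct.comm k H H t) (b p.2 ⊗ₜ b p.1) • (Y p.1 ⊗ₜ[k] Y p.2) = t := fun t => by
    induction t using TensorProduct.induction_on with
    | zero => simp
    | add s t hs ht =>
      simp only [map_add, LinearMap.add_apply, add_smul, Finset.sum_add_distrib, hs, ht]
    | tmul x y =>
      conv_rhs => rw [← hsum x, ← hsum y]
      simp only [TensorProduct.sum_tmul, TensorProduct.tmul_sum]
      rw [Fintype.sum_prod_type_right]
      refine Finset.sum_congr rfl fun p _ => Finset.sum_congr rfl fun q _ => ?_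
      rw [TensorProduct.smul_tmul_smul, TensorProduct.comm_tmul, ev₂_tmul, mul_comm]
  rw [X.krTR_eq l.toForm T Y (fun c p =>
    (if D.sign c = -1 then X.dual.r else X.dual.rbar) (b p.2 ⊗ₜ[k] b p.1))]
  · refine Finset.sum_congr rfl fun s _ => ?_
    congr 1
    refine Finset.prod_congr rfl fun i _ => ?_
    rw [← X.wordForm_dualTrace h hL hL' h1, ← LinkDiagram.pick_ev]
    simp_rw [hY]
    rfl
  · intro c
    split_ifs
    · exact htensor _
    · exact htensor _

/-- As forms on `H`, the two sides are `λ(S(x) G)` and `λ(x G)`; as `S²(G) = G`, the twisted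
symmetry turns them into `λ(G S(x))` and `λ(G x)`. -/
theorem isSCompatible (h : IsRightCointegral l.toForm) (hL : IsLeftIntegral k L)
    (hL' : IsRightIntegral k L) (h1 : l.toForm L = 1) : X.dual.IsSCompatible l := by
  have e : ∀ (g : DualHopf k H →ₗ[k] DualHopf k H) (t : DualHopf k H ⊗[k] DualHopf k H),
      TensorProduct.lid k _ (TensorProduct.map X.dual.wbar g t) =
        g (evalLeft (X.GUnit : H) t) := by
    intro g t
    rw [dual_wbar]
    induction t using TensorProduct.induction_on with
    | zero => simp
    | add s t hs ht => simp only [map_add, hs, ht]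
    | tmul φ ψ => simp
  have hG : antipode k (antipode k (X.GUnit : H)) = (X.GUnit : H) := by
    rw [antipode_sq, Units.mul_inv_cancel_right]
  rw [CoribbonStructure.IsSCompatible, e, e, comul_eq, evalLeft_comulDual]
  refine ext_toForm fun x => ?_
  change l.toForm (antipode k x * X.GUnit) = l.toForm (x * X.GUnit)
  rw [h.apply_mul hL hL' h1, h.apply_mul hL hL' h1 x, hG, X.apply_G_antipode h hL hL' h1]

end Evaluation

end RibbonStructure

/-! ### The main theorem -/

open DualHopf in
theorem mainTheorem10 {k : Type*} [Field k] {H : Type*} [Ring H] [HopfAlgebra k H]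
    [FiniteDimensional k H] (hH : IsUnimodular k H) (X : RibbonStructure k H) :
    ∃ C : CoribbonStructure k (DualHopf k H),
      -- the coribbon structure is the one that is dual to the ribbon structure of `H`
      (∀ φ ψ : DualHopf k H,
        C.r (φ ⊗ₜ[k] ψ) =
          LinearMap.mul' k k (TensorProduct.map ψ.toForm φ.toForm (X.R : H ⊗[k] H))) ∧
      (∀ φ : DualHopf k H, C.nu φ = φ.toForm X.vInv) ∧
      -- the left-integral
      (∃ l : DualHopf k H, l ≠ 0 ∧ IsLeftIntegral k l ∧
        IsDualQuantumTrace k l ∧ C.IsSCompatible l ∧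
        ∀ l' : DualHopf k H, IsLeftIntegral k l' → ∃ c : k, l' = c • l) ∧
      -- the comparison of the invariants
      (∀ l : DualHopf k H, l ≠ 0 → IsLeftIntegral k l →
        IsRightCointegral l.toForm ∧
        ∀ β γ : k, β ≠ 0 → γ ≠ 0 → C.nubar l = γ ^ 2 / β → C.nu l = β →
          γ ^ 2 = l.toForm X.v * l.toForm X.vInv ∧
          (γ / β) ^ 2 = l.toForm X.v / l.toForm X.vInv ∧
          ∀ (D : LinkDiagram) (T : D.Traversal),
            C.invariantI l β γ T = γ⁻¹ * X.krINV l.toForm γ (γ / β) T) := by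
  refine ⟨X.dual, X.dual_r_apply, fun φ => rfl, ?_, fun l hl0 hl => ?_⟩
  · obtain ⟨lam, hlam, h⟩ := exists_isRightCointegral (k := k) (H := H)
    obtain ⟨L, hR, h1⟩ := h.exists_integral hlam
    have hL := (hH L).2 hR
    refine ⟨DualHopf.toForm.symm lam, fun h0 => hlam h0, isLeftIntegral_dual_iff.2 h,
      h.isDualQuantumTrace hL hR h1, X.isSCompatible h hL hR h1, fun l' hl' => ?_⟩
    exact ⟨l'.toForm L, DualHopf.toForm.injective
      (h.unique hL h1 (isLeftIntegral_dual_iff.1 hl'))⟩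
  · have h := isLeftIntegral_dual_iff.1 hl
    refine ⟨h, fun β γ hβ hγ hnubar hnu => ?_⟩
    obtain ⟨L, hR, h1⟩ := h.exists_integral (fun h0 => hl0 h0)
    -- Unimodularity turns the right integral produced by nondegeneracy into a two-sided one.
    have hL := (hH L).2 hR
    change l.toForm X.v = γ ^ 2 / β at hnubar
    change l.toForm X.vInv = β at hnu
    rw [hnubar, hnu]
    refine ⟨by field_simp, by field_simp, fun D T => ?_⟩
    rw [CoribbonStructure.invariantI, RibbonStructure.krINV, X.hkrEvaluation_dual h hL hR h1,
      ← mul_assoc, ← mul_assoc]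
    congr 1
    -- The scalars agree because `β^σ γ^(-σ-m-1) = γ⁻¹ · γ^(-m) · (γ/β)^(-σ)`.
    rw [div_zpow, zpow_neg β, zpow_sub₀ hγ, zpow_sub₀ hγ, zpow_one, zpow_neg γ (T.m : ℤ)]
    field_simp
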